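/- Let $n\ge 1$ be an integer and $R>0$, and let $B_R$ be the open ball of radius $R$ centred at the origin of $\mathbb{R}^n$. Let $V,W:(0,R)\to\mathbb{R}$ with $V\in C^1(0,R)$, $V>0$ and $W\ge 0$ on $(0,R)$. Suppose that $(V,W)$ is an $n$-dimensional Bessel pair on $(0,R)$, that is, the equation $$y''(r)+\Big(\frac{n-1}{r}+\frac{V_r(r)}{V(r)}\Big)y'(r)+\frac{W(r)}{V(r)}\,y(r)=0$$ has a positive solution $y\in C^2(0,R)$. (1) For every radial $u\in C_0^\infty(B_R)$ (smooth, real-valued, with compact support in $B_R$), $$\int_{B_R}V(|x|)|\Delta u|^2dx\ \ge\ \int_{B_R}W(|x|)|\nabla u|^2dx+(n-1)\int_{B_R}\Big(\frac{V(|x|)}{|x|^2}-\frac{V_r(|x|)}{|x|}\Big)|\nabla u|^2dx.\qquad(*)$$ (2) If moreover $V\in C^2(0,R)$ and $$W(r)-\frac{2V(r)}{r^2}+\frac{2V_r(r)}{r}-V_{rr}(r)\ \ge\ 0\quad\text{for all } r\in(0,R),$$ then $(*)$ holds for every $u\in C_0^\infty(B_R)$. Here each integral is the Lebesgue integral $\int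 f^+-\int f^-\in[-\infty,+\infty]$, and $(*)$ is an inequality in $[-\infty,+\infty]$ with the convention $0\cdot(\pm\infty)=0$; nothing is asserted when the right-hand side of $(*)$ is undefined, i.e. of the form $\infty-\infty$ (for $n\ge2$). -/

import Mathlib

open MeasureTheory Set
open scoped ContDiff

/-- `(V, W)` is an `n`-dimensional Bessel pair on `(0, R)`: the equation
`y'' + ((n - 1) / r + V_r / V) y' + (W / V) y = 0` has a positive (classical) solution
on `(0, R)`. -/
def IsBesselPair (n : ℕ) (R : ℝ) (V W : ℝ → ℝ) : Prop :=
  ∃ y : ℝ → ℝ, ContDiffOn ℝ 2 y (Ioo 0 R) ∧ ∀ r ∈ Ioo 0 R,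
    0 < y r ∧
      deriv (deriv y) r + (((n : ℝ) - 1) / r + deriv V r / V r) * deriv y r
        + W r / V r * y r = 0

/-- `u ∈ C_0^∞(B_R)`: `u` is smooth with compact support contained in the open ball `B_R` of
radius `R` about the origin of `ℝⁿ` (and extended by zero). -/
def IsTestFunction (n : ℕ) (R : ℝ) (u : EuclideanSpace ℝ (Fin n) → ℝ) : Prop :=
  ContDiff ℝ ∞ u ∧ HasCompactSupport u ∧ tsupport u ⊆ Metric.ball 0 R

/-- `u` is radial: `u x` depends on `‖x‖` only. -/
def IsRadial (n : ℕ) (u : EuclideanSpace ℝ (Fin n) → ℝ) : Prop :=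
  ∀ x y, ‖x‖ = ‖y‖ → u x = u y

/-- The Lebesgue integral `∫ f⁺ - ∫ f⁻ ∈ [-∞, +∞]` over the ball `B_R` of `ℝⁿ`. It is the
Bochner integral if `f` is integrable, and `+∞` or `-∞` if exactly one of `∫ f⁺`, `∫ f⁻` is
infinite. If both are infinite, the integral does not exist; the arithmetic of `EReal` then
gives `⊥`. -/
noncomputable def ballIntegral (n : ℕ) (R : ℝ) (f : EuclideanSpace ℝ (Fin n) → ℝ) : EReal :=
  ((∫⁻ x in Metric.ball 0 R, ENNReal.ofReal (f x)) : EReal)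
    - ((∫⁻ x in Metric.ball 0 R, ENNReal.ofReal (-f x)) : EReal)

/-- The weighted Hardy-Rellich inequality
`∫ V(|x|) |Δu|² ≥ ∫ W(|x|) |∇u|² + (n - 1) ∫ (V(|x|) / |x|² - V_r(|x|) / |x|) |∇u|²`
on `B_R`, for the function `u`, as an inequality between extended real numbers. -/
def HardyRellichInequality (n : ℕ) (R : ℝ) (V W : ℝ → ℝ)
    (u : EuclideanSpace ℝ (Fin n) → ℝ) : Prop :=
  ballIntegral n R (fun x => V ‖x‖ * Laplacian.laplacian u x ^ 2) ≥
    ballIntegral n R (fun x => W ‖x‖ * ‖gradient u x‖ ^ 2)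
      + (((n : ℝ) - 1 : ℝ) : EReal) *
        ballIntegral n R
          (fun x => (V ‖x‖ / ‖x‖ ^ 2 - deriv V ‖x‖ / ‖x‖) * ‖gradient u x‖ ^ 2)

/-!
Write `Y = y' / y` for the positive solution `y` of the Bessel pair. Then `Y` solves a Riccati
equation, and therefore `r^(n-1) (V a'² - W a²)`, for every function `a` of `r`, is a square plus
the derivative of `V r^(n-1) Y a²`. The proof writes the difference of the two sides as an integral
over an annulus `ε < |x| < b`, with `b` so close to `R` that the outer sphere misses the support
of `u`, in polar coordinates:

* `r² Δu` is the sum of its radial part and of the spherical Laplacian `casimir u`, which is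
  written through the infinitesimal rotations `x_i ∂_j - x_j ∂_i` (`norm_sq_mul_laplacian`,
  `norm_sq_mul_norm_gradient_sq`). No calculus on the sphere is needed: one integrates by parts
  by averaging over the circles that the rotations generate.
* The radial derivative of `u` is treated by the Bessel pair along each ray
  (`IsRiccati.hasDerivAt_radial`). In the tangential directions, integration by parts in the
  angular variables turns the product of the radial part and `casimir u` into twice the weighted
  square of the radial derivative of the tangential gradient. Hence the Bessel pair can be used
  twice there; one copy of `W` is left over, and together with the derivatives of `V` it forms the
  expression that part (2) assumes to be nonnegative (`IsRiccati.hasDerivAt_tangential`). What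
  remains is `∫ |casimir u|² - (n - 1) ∫ |angular gradient|²`, which is nonnegative by the
  spectral gap of the sphere (`integral_angularNormSq_le`): Bochner's formula for `n ≥ 3`,
  Wirtinger's inequality on circles for `n = 2`.

There remain the boundary terms on the inner sphere, where `V` may be singular. They are bounded
by the flux `V r^(n-1) Y`, by `V r^(n-2)` and by `V_r r^(n-1)`.

* In part (2), the hypothesis makes `r Y + r V_r / V - 1` satisfy a differential inequality
  `r S' ≤ -(S - n - 1)² / 4` where it exceeds `n + 1`; such a function would blow up before the
  origin, so that it is at most `n + 1` everywhere (`IsRiccati.riccatiSum_le`). It follows that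
  `V r^(n-2)` tends to zero for `n ≥ 2`, and, by a second blow-up argument, that the flux is
  nonpositive (`IsRiccati.tendsto_boundaryWeight`, `IsRiccati.radialFlux_nonpos`).
* In part (1) there is no such control of `V`, but one may assume `∫ V |Δu|² < ∞`, and then the
  tails of this energy bound the boundary terms for a sequence of radii tending to zero
  (`IsRiccati.radialFlux_mul_sq_le`, `exists_boundaryWeight_mul_sq_le`).

Thus the inequality holds on annuli up to arbitrarily small errors (`HasAnnularBound`). The
annuli exhaust the punctured ball, and monotone convergence for the positive and negative parts
gives the inequality between extended real numbers.
-/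

/-! ### Two inequalities in one variable -/

/-- A solution of the differential inequality `r g' ≤ -k g²` that is positive somewhere blows up
at a positive radius to the left of that point, hence cannot exist on all of `(0, R)`. -/
lemma nonpos_of_mul_deriv_le_neg_sq {R k : ℝ} (hk : 0 < k) {g g' : ℝ → ℝ}
    (hg : ∀ r ∈ Ioo 0 R, HasDerivAt g (g' r) r)
    (h : ∀ r ∈ Ioo 0 R, 0 < g r → r * g' r ≤ -k * g r ^ 2) :
    ∀ r ∈ Ioo 0 R, g r ≤ 0 := by
  intro r₁ hr₁
  by_contra! hc
  -- In the variable `t = log (r₁ / r)` the inequality is autonomous.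
  set f : ℝ → ℝ := fun t => -g (r₁ * Real.exp (-t)) with hf
  have hmem : ∀ t, 0 ≤ t → r₁ * Real.exp (-t) ∈ Ioo 0 R := fun t ht =>
    ⟨mul_pos hr₁.1 (Real.exp_pos _),
      lt_of_le_of_lt (mul_le_of_le_one_right hr₁.1.le (Real.exp_le_one_iff.2 (by linarith))) hr₁.2⟩
  have hfd : ∀ t, 0 ≤ t → HasDerivAt f
      ((r₁ * Real.exp (-t)) * g' (r₁ * Real.exp (-t))) t := by
    intro t ht
    have h1 : HasDerivAt (fun t : ℝ => r₁ * Real.exp (-t)) (r₁ * (Real.exp (-t) * -1)) t :=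
      ((hasDerivAt_neg t).exp).const_mul r₁
    have := ((hg _ (hmem t ht)).comp t h1).neg
    refine this.congr_deriv ?_
    ring
  have hf0 : f 0 = -g r₁ := by simp [hf]
  have hfle : ∀ T, ∀ t ∈ Icc 0 T, f t ≤ f 0 := by
    intro T
    refine image_le_of_deriv_right_lt_deriv_boundary (B := fun _ => f 0) (B' := fun _ => 0)
      (fun t ht => (hfd t ht.1).continuousAt.continuousWithinAt)
      (fun t ht => (hfd t ht.1).hasDerivWithinAt) le_rfl (fun x => hasDerivAt_const x _) ?_
    intro t ht hft
    have hpos : 0 < g (r₁ * Real.exp (-t)) := by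
      have : -g (r₁ * Real.exp (-t)) = f 0 := hft
      rw [hf0] at this; linarith
    have := h _ (hmem t ht.1) hpos
    have h2 : 0 < k * g (r₁ * Real.exp (-t)) ^ 2 := by positivity
    linarith
  set T : ℝ := 2 / (k * g r₁) with hT
  have hTpos : 0 < T := by positivity
  have hneg : ∀ t ∈ Icc 0 T, f t < 0 := fun t ht => by
    have := hfle T t ht; rw [hf0] at this; linarith
  have hmono : MonotoneOn (fun t => (f t)⁻¹ - k * t) (Icc 0 T) := by
    have hd : ∀ t ∈ Icc 0 T, HasDerivAt (fun t => (f t)⁻¹ - k * t)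
        (-((r₁ * Real.exp (-t)) * g' (r₁ * Real.exp (-t))) / f t ^ 2 - k * 1) t := fun t ht =>
      ((hfd t ht.1).inv (hneg t ht).ne).sub ((hasDerivAt_id t).const_mul k)
    refine monotoneOn_of_deriv_nonneg (convex_Icc 0 T)
      (fun t ht => (hd t ht).continuousAt.continuousWithinAt)
      (fun t ht => (hd t (interior_subset ht)).differentiableAt.differentiableWithinAt) ?_
    intro t ht
    have ht' := interior_subset ht
    rw [(hd t ht').deriv]
    have hn := hneg t ht'
    have hpos : 0 < g (r₁ * Real.exp (-t)) := by
      have : f t = -g (r₁ * Real.exp (-t)) := rfl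
      linarith
    have h3 := h _ (hmem t ht'.1) hpos
    have h4 : f t ^ 2 = g (r₁ * Real.exp (-t)) ^ 2 := by simp [hf]
    have h5 : k ≤ -((r₁ * Real.exp (-t)) * g' (r₁ * Real.exp (-t))) / f t ^ 2 := by
      rw [le_div_iff₀ (by rw [h4]; positivity), h4]; linarith
    linarith
  have h6 := hmono (left_mem_Icc.2 hTpos.le) (right_mem_Icc.2 hTpos.le) hTpos.le
  have h7 : (f T)⁻¹ < 0 := inv_lt_zero.2 (hneg T (right_mem_Icc.2 hTpos.le))
  have h8 : k * T = 2 * (g r₁)⁻¹ := by rw [hT]; field_simp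
  have h9 : 0 < (g r₁)⁻¹ := inv_pos.2 hc
  simp only [hf0, h8, mul_zero, sub_zero, inv_neg] at h6
  linarith

/-- Wirtinger's inequality for the derivative of a periodic function. -/
lemma integral_sq_deriv_le_integral_sq_deriv_deriv {F F₁ F₂ : ℝ → ℝ}
    (h₁ : ∀ t, HasDerivAt F (F₁ t) t) (h₂ : ∀ t, HasDerivAt F₁ (F₂ t) t) (hF₂ : Continuous F₂)
    (hper : F (2 * Real.pi) = F 0) (hper₁ : F₁ (2 * Real.pi) = F₁ 0) :
    ∫ t in (0 : ℝ)..2 * Real.pi, F₁ t ^ 2 ≤ ∫ t in (0 : ℝ)..2 * Real.pi, F₂ t ^ 2 := by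
  have hF₁ : Continuous F₁ := continuous_iff_continuousAt.2 fun t => (h₂ t).continuousAt
  have hlt : (0 : ℝ) < 2 * Real.pi := Real.two_pi_pos
  have hmem : ∀ G : ℝ → ℝ, Continuous G →
      MemLp (fun t => (G t : ℂ)) 2 (volume.restrict (Ioc 0 (2 * Real.pi))) := by
    intro G hG
    have hc : Continuous fun t => (G t : ℂ) := Complex.continuous_ofReal.comp hG
    obtain ⟨C, hC⟩ := isCompact_Icc.exists_bound_of_continuousOn
      (hc.continuousOn (s := Icc 0 (2 * Real.pi)))
    refine MemLp.of_bound hc.aestronglyMeasurable C ?_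
    filter_upwards [ae_restrict_mem measurableSet_Ioc] with t ht using hC t (Ioc_subset_Icc_self ht)
  have s₁ := hasSum_sq_fourierCoeffOn hlt (hmem F₁ hF₁)
  have s₂ := hasSum_sq_fourierCoeffOn hlt (hmem F₂ hF₂)
  have key : ∀ i : ℤ, ‖fourierCoeffOn hlt (fun t => (F₁ t : ℂ)) i‖ ^ 2
      ≤ ‖fourierCoeffOn hlt (fun t => (F₂ t : ℂ)) i‖ ^ 2 := by
    intro i
    rcases eq_or_ne i 0 with rfl | hi
    · have hint : ∫ t in (0 : ℝ)..2 * Real.pi, F₁ t = 0 := by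
        rw [intervalIntegral.integral_eq_sub_of_hasDerivAt (fun t _ => h₁ t)
          (hF₁.intervalIntegrable _ _), hper, sub_self]
      have : fourierCoeffOn hlt (fun t => (F₁ t : ℂ)) 0 = 0 := by
        rw [fourierCoeffOn_eq_integral]
        simp only [neg_zero, fourier_zero, one_smul]
        rw [intervalIntegral.integral_ofReal, hint]
        simp
      rw [this, norm_zero, zero_pow two_ne_zero]; positivity
    · have := fourierCoeffOn_of_hasDerivAt hlt hi (f := fun t => (F₁ t : ℂ))
        (f' := fun t => (F₂ t : ℂ)) (fun t _ => (h₂ t).ofReal_comp)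
        ((Complex.continuous_ofReal.comp hF₂).intervalIntegrable _ _)
      rw [this]
      simp only [hper₁, sub_self, mul_zero, zero_sub]
      rw [norm_mul, norm_neg, mul_pow, norm_mul, mul_pow, ← mul_assoc]
      have h1 : (1 : ℝ) ≤ |(i : ℝ)| := by
        rw [← Int.cast_abs]; exact_mod_cast Int.one_le_abs hi
      have hpi := Real.pi_pos
      have : ‖(1 : ℂ) / (-2 * Real.pi * Complex.I * i)‖ ^ 2 * ‖((2 * Real.pi : ℝ) : ℂ)
        - (0 : ℝ)‖ ^ 2
          ≤ 1 := by
        rw [← mul_pow]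
        refine pow_le_one₀ (by positivity) ?_
        simp [abs_of_pos hpi]
        field_simp
        exact h1
      exact mul_le_of_le_one_left (by positivity) this
  have := hasSum_le key s₁ s₂
  simp only [Complex.norm_real, Real.norm_eq_abs, sq_abs, smul_eq_mul] at this
  exact le_of_mul_le_mul_left this (by simp; positivity)

/-! ### The Riccati equation of a Bessel pair -/

lemma hasDerivAt_pow_pred {n : ℕ} (hn : 1 ≤ n) {r : ℝ} (hr : 0 < r) :
    HasDerivAt (fun r : ℝ => r ^ (n - 1)) (((n : ℝ) - 1) * r ^ (n - 1) / r) r := by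
  refine (hasDerivAt_pow (n - 1) r).congr_deriv ?_
  obtain ⟨m, rfl⟩ : ∃ m, n = m + 1 := ⟨n - 1, by omega⟩
  rcases m with _ | m
  · simp
  · simp only [Nat.add_sub_cancel, Nat.cast_add, Nat.cast_one]
    rw [pow_succ]
    field_simp
    ring

lemma ContDiffOn.hasDerivAt_of_isOpen {f : ℝ → ℝ} {s : Set ℝ} (hs : IsOpen s)
    (hf : ContDiffOn ℝ 1 f s) {r : ℝ} (hr : r ∈ s) : HasDerivAt f (deriv f r) r :=
  ((hf.differentiableOn one_ne_zero).differentiableAt (hs.mem_nhds hr)).hasDerivAt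

lemma ContDiffOn.contDiffOn_one_deriv {f : ℝ → ℝ} {s : Set ℝ} (hs : IsOpen s)
    (hf : ContDiffOn ℝ 2 f s) : ContDiffOn ℝ 1 (deriv f) s :=
  hf.deriv_of_isOpen hs (by norm_num)

/-- The function `Y` is the logarithmic derivative `y' / y` of a positive solution `y` of the
equation of an `n`-dimensional Bessel pair: it solves the Riccati equation. -/
def IsRiccati (n : ℕ) (R : ℝ) (V W Y : ℝ → ℝ) : Prop :=
  ∀ r ∈ Ioo 0 R, HasDerivAt Y
    (-((((n : ℝ) - 1) / r + deriv V r / V r) * Y r) - W r / V r - Y r ^ 2) r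

lemma IsBesselPair.exists_isRiccati {n : ℕ} {R : ℝ} {V W : ℝ → ℝ} (h : IsBesselPair n R V W) :
    ∃ Y, IsRiccati n R V W Y := by
  obtain ⟨y, hy, h⟩ := h
  refine ⟨fun r => deriv y r / y r, fun r hr => ?_⟩
  have h1 := (hy.of_le one_le_two).hasDerivAt_of_isOpen isOpen_Ioo hr
  have h2 := (hy.contDiffOn_one_deriv isOpen_Ioo).hasDerivAt_of_isOpen isOpen_Ioo hr
  obtain ⟨hpos, heq⟩ := h r hr
  refine (h2.div h1 hpos.ne').congr_deriv ?_
  have h3 : deriv (deriv y) r = -((((n : ℝ) - 1) / r + deriv V r / V r) * deriv y r)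
      - W r / V r * y r := by linarith
  rw [h3]
  field_simp

lemma IsBesselPair.continuousOn {n : ℕ} {R : ℝ} {V W : ℝ → ℝ} (h : IsBesselPair n R V W)
    (hV : ContDiffOn ℝ 1 V (Ioo 0 R)) (hVpos : ∀ r ∈ Ioo 0 R, 0 < V r) :
    ContinuousOn W (Ioo 0 R) := by
  obtain ⟨y, hy, h⟩ := h
  have c0 := hy.continuousOn
  have c1 := (hy.contDiffOn_one_deriv isOpen_Ioo).continuousOn
  have c2 := (hy.contDiffOn_one_deriv isOpen_Ioo).continuousOn_deriv_of_isOpen isOpen_Ioo le_rfl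
  have v0 := hV.continuousOn
  have v1 := hV.continuousOn_deriv_of_isOpen isOpen_Ioo le_rfl
  have hV0 : ∀ r ∈ Ioo 0 R, V r ≠ 0 := fun r hr => (hVpos r hr).ne'
  have hr0 : ∀ r ∈ Ioo 0 R, r ≠ 0 := fun r hr => hr.1.ne'
  have hy0 : ∀ r ∈ Ioo 0 R, y r ≠ 0 := fun r hr => (h r hr).1.ne'
  have : ContinuousOn (fun r => -(V r / y r) * (deriv (deriv y) r
      + (((n : ℝ) - 1) / r + deriv V r / V r) * deriv y r)) (Ioo 0 R) :=
    ((v0.div c0 hy0).neg).mul (c2.add (((continuousOn_const.div continuousOn_id hr0).add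
      (v1.div v0 hV0)).mul c1))
  refine this.congr fun r hr => ?_
  obtain ⟨hpos, heq⟩ := h r hr
  have h3 : deriv (deriv y) r + (((n : ℝ) - 1) / r + deriv V r / V r) * deriv y r
      = - (W r / V r * y r) := by linarith
  simp only [h3]
  have := hV0 r hr
  field_simp

/-- The flux `V r^(n-1) Y`. -/
def radialFlux (n : ℕ) (V Y : ℝ → ℝ) (r : ℝ) : ℝ := V r * r ^ (n - 1) * Y r

/-- The boundary weight `V r^(n-2)`. -/
noncomputable def boundaryWeight (n : ℕ) (V : ℝ → ℝ) (r : ℝ) : ℝ := V r * r ^ (n - 1) / r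

section

variable {n : ℕ} {R : ℝ} {V W Y : ℝ → ℝ}

lemma IsRiccati.hasDerivAt_radialFlux (hn : 1 ≤ n) (hV : ContDiffOn ℝ 1 V (Ioo 0 R))
    (hVpos : ∀ r ∈ Ioo 0 R, 0 < V r) (hY : IsRiccati n R V W Y) {r : ℝ} (hr : r ∈ Ioo 0 R) :
    HasDerivAt (radialFlux n V Y) (-(W r * r ^ (n - 1)) - V r * r ^ (n - 1) * Y r ^ 2) r := by
  refine (((hV.hasDerivAt_of_isOpen isOpen_Ioo hr).mul (hasDerivAt_pow_pred hn hr.1)).mul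
    (hY r hr)).congr_deriv ?_
  have h1 := (hVpos r hr).ne'
  have h2 := hr.1.ne'
  simp only [Pi.mul_apply]
  field_simp
  ring

lemma hasDerivAt_boundaryWeight (hn : 1 ≤ n) (hV : ContDiffOn ℝ 1 V (Ioo 0 R))
    {r : ℝ} (hr : r ∈ Ioo 0 R) :
    HasDerivAt (boundaryWeight n V)
      ((deriv V r + ((n : ℝ) - 2) * V r / r) * r ^ (n - 1) / r) r := by
  refine (((hV.hasDerivAt_of_isOpen isOpen_Ioo hr).mul (hasDerivAt_pow_pred hn hr.1)).div
    (hasDerivAt_id r) hr.1.ne').congr_deriv ?_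
  have h2 := hr.1.ne'
  simp only [id, Pi.mul_apply]
  field_simp
  ring

/-- The Bessel pair, in the form of an exact identity for the radial derivative `a = u_r` along
a ray: the integrand of the inequality is a square plus a derivative. -/
lemma IsRiccati.hasDerivAt_radial (hn : 1 ≤ n) (hV : ContDiffOn ℝ 1 V (Ioo 0 R))
    (hVpos : ∀ r ∈ Ioo 0 R, 0 < V r) (hY : IsRiccati n R V W Y) {r : ℝ} (hr : r ∈ Ioo 0 R)
    {a : ℝ → ℝ} {a' : ℝ} (ha : HasDerivAt a a' r) :
    HasDerivAt (fun r => (radialFlux n V Y r + ((n : ℝ) - 1) * boundaryWeight n V r) * a r ^ 2)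
      (r ^ (n - 1) * (V r * (a' + ((n : ℝ) - 1) * a r / r) ^ 2
        - (W r + ((n : ℝ) - 1) * (V r / r ^ 2 - deriv V r / r)) * a r ^ 2)
        - V r * r ^ (n - 1) * (a' - Y r * a r) ^ 2) r := by
  refine (((hY.hasDerivAt_radialFlux hn hV hVpos hr).add
    ((hasDerivAt_boundaryWeight hn hV hr).const_mul _)).mul (ha.pow 2)).congr_deriv ?_
  have h1 := (hVpos r hr).ne'
  have h2 := hr.1.ne'
  simp only [radialFlux, boundaryWeight, Pi.add_apply, Pi.pow_apply]
  field_simp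
  ring

/-- The analogue of `IsRiccati.hasDerivAt_radial` for a component `b` of the tangential
gradient, where `α = (r b)'`. Here the Bessel pair is used twice; the excess pays for the
curvature term of the hypothesis on `V` and `W`. -/
lemma IsRiccati.hasDerivAt_tangential (hn : 1 ≤ n) (hV : ContDiffOn ℝ 2 V (Ioo 0 R))
    (hVpos : ∀ r ∈ Ioo 0 R, 0 < V r) (hY : IsRiccati n R V W Y) {r : ℝ} (hr : r ∈ Ioo 0 R)
    {b α : ℝ → ℝ} {α' : ℝ} (hb : HasDerivAt b ((α r - b r) / r) r) (hα : HasDerivAt α α' r) :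
    HasDerivAt (fun r => (2 * radialFlux n V Y r + deriv V r * r ^ (n - 1)) * b r ^ 2
        - 2 * boundaryWeight n V r * (b r * α r))
      (r ^ (n - 1) * (-2 * V r / r ^ 2 * ((r * α' + ((n : ℝ) - 1) * α r) * b r)
        + ((n : ℝ) - 1) * V r / r ^ 2 * b r ^ 2
        - (W r + ((n : ℝ) - 1) * (V r / r ^ 2 - deriv V r / r)) * b r ^ 2)
        - 2 * (V r * r ^ (n - 1) * ((α r - b r) / r - Y r * b r) ^ 2)
        - r ^ (n - 1) * ((W r - 2 * V r / r ^ 2 + 2 * deriv V r / r - deriv (deriv V) r)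
          * b r ^ 2)) r := by
  have hV1 := hV.of_le one_le_two
  have hV2 := (hV.contDiffOn_one_deriv isOpen_Ioo).hasDerivAt_of_isOpen isOpen_Ioo hr
  refine (((((hY.hasDerivAt_radialFlux hn hV1 hVpos hr).const_mul 2).add
    (hV2.mul (hasDerivAt_pow_pred hn hr.1))).mul (hb.pow 2)).sub
    (((hasDerivAt_boundaryWeight hn hV1 hr).const_mul 2).mul (hb.mul hα))).congr_deriv ?_
  have h1 := (hVpos r hr).ne'
  have h2 := hr.1.ne'
  simp only [radialFlux, boundaryWeight, Pi.add_apply, Pi.pow_apply, Pi.mul_apply]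
  field_simp
  ring

/-- The sum of the logarithmic derivatives of `y` and of `V / r` with respect to `log r`. -/
noncomputable def riccatiSum (V Y : ℝ → ℝ) (r : ℝ) : ℝ := r * Y r + (r * (deriv V r / V r) - 1)

lemma IsRiccati.exists_hasDerivAt_riccatiSum (hV : ContDiffOn ℝ 2 V (Ioo 0 R))
    (hVpos : ∀ r ∈ Ioo 0 R, 0 < V r) (hY : IsRiccati n R V W Y)
    (hcond : ∀ r ∈ Ioo 0 R,
      0 ≤ W r - 2 * V r / r ^ 2 + 2 * deriv V r / r - deriv (deriv V) r) :
    ∃ τ' : ℝ → ℝ, ∀ r ∈ Ioo 0 R, HasDerivAt (riccatiSum V Y) (τ' r) r ∧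
      r * τ' r ≤ -((r * Y r) ^ 2 + ((n : ℝ) - 1 + (r * (deriv V r / V r) - 1)) * (r * Y r)
        + (r * (deriv V r / V r) - 1) ^ 2 - (r * (deriv V r / V r) - 1)) := by
  refine ⟨fun r => (1 * Y r + r * (-((((n : ℝ) - 1) / r + deriv V r / V r) * Y r)
    - W r / V r - Y r ^ 2)) + (1 * (deriv V r / V r) + r * ((deriv (deriv V) r * V r
      - deriv V r * deriv V r) / V r ^ 2)), fun r hr => ⟨?_, ?_⟩⟩
  · have hV1 := (hV.of_le one_le_two).hasDerivAt_of_isOpen isOpen_Ioo hr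
    have hV2 := (hV.contDiffOn_one_deriv isOpen_Ioo).hasDerivAt_of_isOpen isOpen_Ioo hr
    exact ((hasDerivAt_id r).mul (hY r hr)).add
      (((hasDerivAt_id r).mul (hV2.div hV1 (hVpos r hr).ne')).sub_const 1)
  · have h1 := hVpos r hr
    have h2 := hr.1
    have h3 : 0 ≤ r ^ 2 / V r * (W r - 2 * V r / r ^ 2 + 2 * deriv V r / r - deriv (deriv V) r) :=
      mul_nonneg (by positivity) (hcond r hr)
    have h4 := h1.ne'
    have h5 := h2.ne'
    rw [← sub_nonneg]
    convert h3 using 1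
    field_simp
    ring

/-- The crucial a priori bound: a Riccati-type inequality forces the sum to stay below `n + 1`
all the way down to the origin. -/
lemma IsRiccati.riccatiSum_le (hn : 1 ≤ n) (hV : ContDiffOn ℝ 2 V (Ioo 0 R))
    (hVpos : ∀ r ∈ Ioo 0 R, 0 < V r) (hY : IsRiccati n R V W Y)
    (hcond : ∀ r ∈ Ioo 0 R,
      0 ≤ W r - 2 * V r / r ^ 2 + 2 * deriv V r / r - deriv (deriv V) r) :
    ∀ r ∈ Ioo 0 R, riccatiSum V Y r ≤ n + 1 := by
  obtain ⟨τ', hτ⟩ := hY.exists_hasDerivAt_riccatiSum hV hVpos hcond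
  have := nonpos_of_mul_deriv_le_neg_sq (k := 1 / 4) (by norm_num)
    (g := fun r => riccatiSum V Y r - (n + 1)) (g' := τ')
    (fun r hr => (hτ r hr).1.sub_const _) (R := R) ?_
  · intro r hr; linarith [this r hr]
  · intro r hr hpos
    refine (hτ r hr).2.trans ?_
    simp only [riccatiSum] at hpos ⊢
    set ρ := r * Y r
    set κ := r * (deriv V r / V r) - 1
    have hn' : (1 : ℝ) ≤ n := by exact_mod_cast hn
    -- For a given sum `ρ + κ`, the quadratic form is minimal at `κ = (ρ + κ + n) / 2`.
    nlinarith [sq_nonneg (2 * κ - (ρ + κ + n)), mul_pos hpos hpos,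
      mul_nonneg (by linarith : (0 : ℝ) ≤ (n : ℝ) - 1) hpos.le]

/-- `V r^(n-2)` is bounded near the origin by a constant times a power of `r`, and the exponent is
positive if `n ≥ 2`. The differential inequality for `riccatiSum` bounds its derivative by that of
the logarithm of `V r^(n-2)`, up to a multiple of `log r`. -/
lemma IsRiccati.exists_log_boundaryWeight_le (hn : 1 ≤ n) (hV : ContDiffOn ℝ 2 V (Ioo 0 R))
    (hVpos : ∀ r ∈ Ioo 0 R, 0 < V r) (hY : IsRiccati n R V W Y)
    (hcond : ∀ r ∈ Ioo 0 R,
      0 ≤ W r - 2 * V r / r ^ 2 + 2 * deriv V r / r - deriv (deriv V) r)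
    {r₀ : ℝ} (hr₀ : r₀ ∈ Ioo 0 R) :
    ∃ C : ℝ, ∀ r ∈ Ioc 0 r₀,
      (2 * (n : ℝ) - 1) * Real.log (boundaryWeight n V r) ≤ C + n * ((n : ℝ) - 1) * Real.log r := by
  obtain ⟨τ', hτ⟩ := hY.exists_hasDerivAt_riccatiSum hV hVpos hcond
  have hV1 := hV.of_le one_le_two
  have hPpos : ∀ r ∈ Ioo 0 R, 0 < boundaryWeight n V r := fun r hr =>
    div_pos (mul_pos (hVpos r hr) (pow_pos hr.1 _)) hr.1
  set f : ℝ → ℝ := fun r => (2 * (n : ℝ) - 1) * Real.log (boundaryWeight n V r)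
    - riccatiSum V Y r - n * ((n : ℝ) - 1) * Real.log r with hf
  have hfd : ∀ r ∈ Ioo 0 R, HasDerivAt f ((2 * (n : ℝ) - 1) *
      ((deriv V r + ((n : ℝ) - 2) * V r / r) * r ^ (n - 1) / r / boundaryWeight n V r) - τ' r
      - n * ((n : ℝ) - 1) * r⁻¹) r := fun r hr =>
    ((((hasDerivAt_boundaryWeight hn hV1 hr).log (hPpos r hr).ne').const_mul _).sub
      (hτ r hr).1).sub ((Real.hasDerivAt_log hr.1.ne').const_mul _)
  have hmono : MonotoneOn f (Ioo 0 R) := by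
    refine monotoneOn_of_deriv_nonneg (convex_Ioo 0 R)
      (fun r hr => (hfd r hr).continuousAt.continuousWithinAt)
      (fun r hr => (hfd r (interior_subset hr)).differentiableAt.differentiableWithinAt) ?_
    intro r hr
    have hr := interior_subset hr
    rw [(hfd r hr).deriv]
    have h1 := (hτ r hr).2
    have h2 := hr.1
    have h3 := hVpos r hr
    have h4 : (deriv V r + ((n : ℝ) - 2) * V r / r) * r ^ (n - 1) / r / boundaryWeight n V r
        = ((r * (deriv V r / V r) - 1) + n - 1) / r := by
      rw [boundaryWeight]; field_simp; ring
    rw [h4]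
    set ρ := r * Y r
    set κ := r * (deriv V r / V r) - 1
    have h5 : r * τ' r ≤ (2 * (n : ℝ) - 1) * (κ + n - 1) - n * ((n : ℝ) - 1) := by
      refine h1.trans ?_
      nlinarith [sq_nonneg (2 * ρ + (n - 1 + κ)), sq_nonneg (κ + n - 1)]
    have h6 : (2 * (n : ℝ) - 1) * ((κ + n - 1) / r) - τ' r - n * ((n : ℝ) - 1) * r⁻¹
        = ((2 * (n : ℝ) - 1) * (κ + n - 1) - n * ((n : ℝ) - 1) - r * τ' r) / r := by
      field_simp
      ring
    rw [h6]
    exact div_nonneg (by linarith) h2.le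
  refine ⟨f r₀ + (n + 1), fun r hr => ?_⟩
  have hr' : r ∈ Ioo 0 R := ⟨hr.1, hr.2.trans_lt hr₀.2⟩
  have h1 := hmono hr' hr₀ hr.2
  have h2 := hY.riccatiSum_le hn hV hVpos hcond r hr'
  have h3 : f r = (2 * (n : ℝ) - 1) * Real.log (boundaryWeight n V r)
    - riccatiSum V Y r - n * ((n : ℝ) - 1) * Real.log r := rfl
  linarith

lemma boundaryWeight_pos (hVpos : ∀ r ∈ Ioo 0 R, 0 < V r) {r : ℝ} (hr : r ∈ Ioo 0 R) :
    0 < boundaryWeight n V r :=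
  div_pos (mul_pos (hVpos r hr) (pow_pos hr.1 _)) hr.1

lemma IsRiccati.exists_boundaryWeight_le (hn : 1 ≤ n) (hV : ContDiffOn ℝ 2 V (Ioo 0 R))
    (hVpos : ∀ r ∈ Ioo 0 R, 0 < V r) (hY : IsRiccati n R V W Y)
    (hcond : ∀ r ∈ Ioo 0 R,
      0 ≤ W r - 2 * V r / r ^ 2 + 2 * deriv V r / r - deriv (deriv V) r)
    {r₀ : ℝ} (hr₀ : r₀ ∈ Ioo 0 R) :
    ∃ C : ℝ, 0 < C ∧ ∀ r ∈ Ioc 0 r₀, boundaryWeight n V r ≤ C := by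
  obtain ⟨C, hC⟩ := hY.exists_log_boundaryWeight_le hn hV hVpos hcond hr₀
  have hn' : (1 : ℝ) ≤ n := by exact_mod_cast hn
  refine ⟨Real.exp ((C + n * ((n : ℝ) - 1) * Real.log r₀) / (2 * n - 1)), Real.exp_pos _,
    fun r hr => ?_⟩
  have hr' : r ∈ Ioo 0 R := ⟨hr.1, hr.2.trans_lt hr₀.2⟩
  rw [← Real.log_le_iff_le_exp (boundaryWeight_pos hVpos hr'), le_div_iff₀' (by linarith)]
  refine (hC r hr).trans ?_
  have := Real.log_le_log hr.1 hr.2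
  have h0 : 0 ≤ n * ((n : ℝ) - 1) := mul_nonneg (by linarith) (by linarith)
  nlinarith [mul_le_mul_of_nonneg_left this h0]

lemma IsRiccati.tendsto_boundaryWeight (hn : 2 ≤ n) (hR : 0 < R)
    (hV : ContDiffOn ℝ 2 V (Ioo 0 R))
    (hVpos : ∀ r ∈ Ioo 0 R, 0 < V r) (hY : IsRiccati n R V W Y)
    (hcond : ∀ r ∈ Ioo 0 R,
      0 ≤ W r - 2 * V r / r ^ 2 + 2 * deriv V r / r - deriv (deriv V) r) :
    Filter.Tendsto (boundaryWeight n V) (nhdsWithin 0 (Ioi 0)) (nhds 0) := by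
  have hr₀ : R / 2 ∈ Ioo 0 R := ⟨by linarith, by linarith⟩
  obtain ⟨C, hC⟩ := hY.exists_log_boundaryWeight_le (by omega) hV hVpos hcond hr₀
  have hn' : (2 : ℝ) ≤ n := by exact_mod_cast hn
  have hlim : Filter.Tendsto
      (fun r => Real.exp ((C + n * ((n : ℝ) - 1) * Real.log r) / (2 * n - 1)))
      (nhdsWithin 0 (Ioi 0)) (nhds 0) := by
    refine Real.tendsto_exp_atBot.comp (Filter.Tendsto.atBot_div_const (by linarith) ?_)
    refine Filter.tendsto_atBot_add_const_left _ _ ?_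
    exact Real.tendsto_log_nhdsGT_zero.const_mul_atBot
      (mul_pos (by linarith) (by linarith))
  have hmem : Ioc 0 (R / 2) ∈ nhdsWithin (0 : ℝ) (Ioi 0) := Ioc_mem_nhdsGT hr₀.1
  refine tendsto_of_tendsto_of_tendsto_of_le_of_le' tendsto_const_nhds hlim ?_ ?_
  · filter_upwards [hmem] with r hr
    exact (boundaryWeight_pos hVpos ⟨hr.1, hr.2.trans_lt hr₀.2⟩).le
  · filter_upwards [hmem] with r hr
    rw [← Real.log_le_iff_le_exp (boundaryWeight_pos hVpos ⟨hr.1, hr.2.trans_lt hr₀.2⟩),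
      le_div_iff₀' (by linarith)]
    exact hC r hr

/-- The positive solution `y` is nonincreasing: if its flux were positive somewhere, then, since
`V r^(n-2)` is bounded near the origin, the flux would blow up at a positive radius. -/
lemma IsRiccati.radialFlux_nonpos (hn : 1 ≤ n) (hV : ContDiffOn ℝ 2 V (Ioo 0 R))
    (hVpos : ∀ r ∈ Ioo 0 R, 0 < V r) (hWnonneg : ∀ r ∈ Ioo 0 R, 0 ≤ W r)
    (hY : IsRiccati n R V W Y)
    (hcond : ∀ r ∈ Ioo 0 R,
      0 ≤ W r - 2 * V r / r ^ 2 + 2 * deriv V r / r - deriv (deriv V) r) :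
    ∀ r ∈ Ioo 0 R, radialFlux n V Y r ≤ 0 := by
  intro r hr
  obtain ⟨r₀, h1, h2⟩ := exists_between hr.2
  have hr₀ : r₀ ∈ Ioo 0 R := ⟨hr.1.trans h1, h2⟩
  obtain ⟨C, hCpos, hC⟩ := hY.exists_boundaryWeight_le hn hV hVpos hcond hr₀
  have hsub : ∀ r ∈ Ioo 0 r₀, r ∈ Ioo 0 R := fun r hr => ⟨hr.1, hr.2.trans h2⟩
  refine nonpos_of_mul_deriv_le_neg_sq (k := 1 / C) (R := r₀) (by positivity)
    (fun r hr => hY.hasDerivAt_radialFlux hn (hV.of_le one_le_two) hVpos (hsub r hr)) ?_ r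
    ⟨hr.1, h1⟩
  intro r hr _
  have hP := boundaryWeight_pos (n := n) hVpos (hsub r hr)
  have hPC := hC r ⟨hr.1, hr.2.le⟩
  have hr0 := hr.1
  have hV0 := hVpos r (hsub r hr)
  have hW0 := hWnonneg r (hsub r hr)
  have h3 : r * (V r * r ^ (n - 1) * Y r ^ 2) = radialFlux n V Y r ^ 2 / boundaryWeight n V r := by
    rw [radialFlux, boundaryWeight]; field_simp
  have h4 : 1 / C * radialFlux n V Y r ^ 2 ≤ radialFlux n V Y r ^ 2 / boundaryWeight n V r := by
    rw [div_mul_eq_mul_div, one_mul]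
    gcongr
  have h5 : 0 ≤ r * (W r * r ^ (n - 1)) := by positivity
  linarith

/-- An upper bound for the coefficient of the tangential boundary term. No lower bound of the flux
is available, but only the upper one is needed. -/
lemma IsRiccati.tangential_boundary_le (hn : 1 ≤ n) (hV : ContDiffOn ℝ 2 V (Ioo 0 R))
    (hVpos : ∀ r ∈ Ioo 0 R, 0 < V r) (hWnonneg : ∀ r ∈ Ioo 0 R, 0 ≤ W r)
    (hY : IsRiccati n R V W Y)
    (hcond : ∀ r ∈ Ioo 0 R,
      0 ≤ W r - 2 * V r / r ^ 2 + 2 * deriv V r / r - deriv (deriv V) r)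
    {r : ℝ} (hr : r ∈ Ioo 0 R) :
    2 * radialFlux n V Y r + deriv V r * r ^ (n - 1) ≤ (n + 2) * boundaryWeight n V r := by
  have h1 := hY.radialFlux_nonpos hn hV hVpos hWnonneg hcond r hr
  have h2 := hY.riccatiSum_le hn hV hVpos hcond r hr
  have hP := boundaryWeight_pos (n := n) hVpos hr
  have hr0 := hr.1
  have hV0 := hVpos r hr
  have h3 : 2 * radialFlux n V Y r + deriv V r * r ^ (n - 1)
      = radialFlux n V Y r + (riccatiSum V Y r + 1) * boundaryWeight n V r := by
    rw [radialFlux, boundaryWeight, riccatiSum]; field_simp; ring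
  nlinarith [mul_le_mul_of_nonneg_right h2 hP.le]

end

/-! ### Algebra of infinitesimal rotations -/

section

open Matrix

variable {ι : Type*} [Fintype ι]

/-- Lagrange's identity, in polarized form. -/
lemma sum_wedge_mul_wedge (a b c d : ι → ℝ) :
    ∑ i, ∑ j, (a i * b j - a j * b i) * (c i * d j - c j * d i)
      = 2 * ((a ⬝ᵥ c) * (b ⬝ᵥ d) - (a ⬝ᵥ d) * (b ⬝ᵥ c)) := by
  have h : ∀ p q r s : ι → ℝ, ∑ i, ∑ j, p i * q j * (r i * s j) = (p ⬝ᵥ r) * (q ⬝ᵥ s) := by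
    intro p q r s
    simp only [dotProduct, Finset.sum_mul_sum]
    exact Finset.sum_congr rfl fun i _ => Finset.sum_congr rfl fun j _ => by ring
  have e : ∀ i j, (a i * b j - a j * b i) * (c i * d j - c j * d i)
      = a i * b j * (c i * d j) - a i * b j * (d i * c j)
        - (b i * a j * (c i * d j) - b i * a j * (d i * c j)) := fun i j => by ring
  simp only [e, Finset.sum_sub_distrib, h]
  ring

lemma dotProduct_mulVec_symm {h : Matrix ι ι ℝ} (hs : h.IsSymm) (v w : ι → ℝ) :
    v ⬝ᵥ (h *ᵥ w) = w ⬝ᵥ (h *ᵥ v) := by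
  rw [dotProduct_mulVec, ← mulVec_transpose, hs.eq, dotProduct_comm]

variable [DecidableEq ι]

/-- The value at `x` of the infinitesimal rotation in the coordinate plane `(k, l)`. -/
def rotVec (x : ι → ℝ) (k l : ι) : ι → ℝ := x k • Pi.single l 1 - x l • Pi.single k 1

lemma rotVec_dotProduct (x v : ι → ℝ) (k l : ι) :
    rotVec x k l ⬝ᵥ v = x k * v l - x l * v k := by
  simp [rotVec, sub_dotProduct]

lemma dotProduct_rotVec_self (x : ι → ℝ) (k l : ι) : x ⬝ᵥ rotVec x k l = 0 := by
  rw [dotProduct_comm, rotVec_dotProduct]; ring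

/-- The infinitesimal rotations at `x` form a tight frame of the hyperplane orthogonal to `x`. -/
lemma sum_rotVec_dotProduct_mul (x v w : ι → ℝ) :
    ∑ k, ∑ l, (rotVec x k l ⬝ᵥ v) * (rotVec x k l ⬝ᵥ w)
      = 2 * ((x ⬝ᵥ x) * (v ⬝ᵥ w) - (x ⬝ᵥ v) * (x ⬝ᵥ w)) := by
  simp only [rotVec_dotProduct]
  rw [sum_wedge_mul_wedge, dotProduct_comm v x]
  ring

lemma sum_rotVec_mulVec (x : ι → ℝ) (A B : Matrix ι ι ℝ) :
    ∑ k, ∑ l, (A *ᵥ rotVec x k l) ⬝ᵥ (B *ᵥ rotVec x k l)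
      = 2 * ∑ m, ((x ⬝ᵥ x) * (A m ⬝ᵥ B m) - (A *ᵥ x) m * (B *ᵥ x) m) := by
  have : ∀ k l, (A *ᵥ rotVec x k l) ⬝ᵥ (B *ᵥ rotVec x k l)
      = ∑ m, (rotVec x k l ⬝ᵥ A m) * (rotVec x k l ⬝ᵥ B m) := fun k l => by
    simp only [dotProduct_comm (rotVec x k l)]; rfl
  simp only [this]
  rw [Finset.sum_congr rfl fun k _ => Finset.sum_comm, Finset.sum_comm, Finset.mul_sum]
  refine Finset.sum_congr rfl fun m _ => ?_
  rw [sum_rotVec_dotProduct_mul, dotProduct_comm x (A m), dotProduct_comm x (B m)]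
  rfl

variable {x : ι → ℝ} {h : Matrix ι ι ℝ}

lemma sum_rotVec_dotProduct_self (x : ι → ℝ) :
    ∑ k, ∑ l, rotVec x k l ⬝ᵥ rotVec x k l = 2 * (((Fintype.card ι : ℝ) - 1) * (x ⬝ᵥ x)) := by
  have := sum_rotVec_mulVec x (1 : Matrix ι ι ℝ) 1
  simp only [one_mulVec] at this
  rw [this, Finset.sum_sub_distrib, ← Finset.mul_sum]
  have h1 : ∑ m, (1 : Matrix ι ι ℝ) m ⬝ᵥ (1 : Matrix ι ι ℝ) m = Fintype.card ι := by
    have : ∀ m, (1 : Matrix ι ι ℝ) m ⬝ᵥ (1 : Matrix ι ι ℝ) m = 1 := fun m => by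
      simp [dotProduct, Matrix.one_apply]
    simp [this]
  rw [h1, show ∑ m, x m * x m = x ⬝ᵥ x from rfl]
  ring

lemma sum_rotVec_dotProduct_mulVec (x : ι → ℝ) (h : Matrix ι ι ℝ) :
    ∑ k, ∑ l, rotVec x k l ⬝ᵥ (h *ᵥ rotVec x k l)
      = 2 * ((x ⬝ᵥ x) * h.trace - x ⬝ᵥ (h *ᵥ x)) := by
  have := sum_rotVec_mulVec x (1 : Matrix ι ι ℝ) h
  simp only [one_mulVec] at this
  rw [this, Finset.sum_sub_distrib, ← Finset.mul_sum]
  have h1 : ∑ m, (1 : Matrix ι ι ℝ) m ⬝ᵥ h m = h.trace := by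
    refine Finset.sum_congr rfl fun m _ => ?_
    simp [dotProduct, Matrix.one_apply]
  rw [h1]
  rfl

/-- The squared Hilbert-Schmidt norm of the compression of `r² h` to the orthogonal complement of
`x`, where `r = |x|`. -/
def tangentialNormSq (x : ι → ℝ) (h : Matrix ι ι ℝ) : ℝ :=
  (x ⬝ᵥ x) * ((x ⬝ᵥ x) * ∑ m, h m ⬝ᵥ h m - (h *ᵥ x) ⬝ᵥ (h *ᵥ x))
    - ((x ⬝ᵥ x) * ((h *ᵥ x) ⬝ᵥ (h *ᵥ x)) - (x ⬝ᵥ (h *ᵥ x)) ^ 2)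

lemma sum_mulVec_rotVec_normSq (x : ι → ℝ) (h : Matrix ι ι ℝ) :
    ∑ k, ∑ l, (h *ᵥ rotVec x k l) ⬝ᵥ (h *ᵥ rotVec x k l)
      = 2 * ((x ⬝ᵥ x) * ∑ m, h m ⬝ᵥ h m - (h *ᵥ x) ⬝ᵥ (h *ᵥ x)) := by
  rw [sum_rotVec_mulVec, Finset.sum_sub_distrib, ← Finset.mul_sum]
  rfl

lemma sum_dotProduct_mulVec_rotVec_sq (hs : h.IsSymm) (v : ι → ℝ) :
    ∑ k, ∑ l, (v ⬝ᵥ (h *ᵥ rotVec x k l)) ^ 2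
      = 2 * ((x ⬝ᵥ x) * ((h *ᵥ v) ⬝ᵥ (h *ᵥ v)) - (x ⬝ᵥ (h *ᵥ v)) ^ 2) := by
  have := sum_rotVec_dotProduct_mul x (h *ᵥ v) (h *ᵥ v)
  simp only [dotProduct_mulVec_symm hs v, sq]
  exact this

lemma sum_sq_eq_tangentialNormSq (hs : h.IsSymm) :
    ∑ k, ∑ l, ∑ i, ∑ j, (rotVec x k l ⬝ᵥ (h *ᵥ rotVec x i j)) ^ 2
      = 4 * tangentialNormSq x h := by
  simp only [sum_dotProduct_mulVec_rotVec_sq hs]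
  simp only [← Finset.mul_sum, Finset.sum_sub_distrib, sum_mulVec_rotVec_normSq,
    sum_dotProduct_mulVec_rotVec_sq hs x, tangentialNormSq]
  ring

/-- The Cauchy-Schwarz inequality between the trace and the Hilbert-Schmidt norm, on the
orthogonal complement of `x`. -/
lemma tangential_trace_sq_le (hs : h.IsSymm) (hx : x ⬝ᵥ x ≠ 0) :
    ((x ⬝ᵥ x) * h.trace - x ⬝ᵥ (h *ᵥ x)) ^ 2
      ≤ ((Fintype.card ι : ℝ) - 1) * tangentialNormSq x h := by
  have hcs := Finset.sum_mul_sq_le_sq_mul_sq (Finset.univ : Finset (ι × ι × ι × ι))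
    (fun p => rotVec x p.1 p.2.1 ⬝ᵥ (h *ᵥ rotVec x p.2.2.1 p.2.2.2))
    (fun p => rotVec x p.1 p.2.1 ⬝ᵥ rotVec x p.2.2.1 p.2.2.2)
  simp only [Fintype.sum_prod_type] at hcs
  have hone := sum_sq_eq_tangentialNormSq (x := x) (h := (1 : Matrix ι ι ℝ)) Matrix.isSymm_one
  simp only [one_mulVec] at hone
  rw [sum_sq_eq_tangentialNormSq hs, hone] at hcs
  have h1 : ∀ k l, ∑ i, ∑ j, (rotVec x k l ⬝ᵥ (h *ᵥ rotVec x i j))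
      * (rotVec x k l ⬝ᵥ rotVec x i j) = 2
        * ((x ⬝ᵥ x) * (rotVec x k l ⬝ᵥ (h *ᵥ rotVec x k l))) := by
    intro k l
    have := sum_rotVec_dotProduct_mul x (h *ᵥ rotVec x k l) (rotVec x k l)
    rw [dotProduct_rotVec_self, mul_zero, sub_zero, dotProduct_comm (h *ᵥ rotVec x k l)] at this
    rw [← this]
    refine Finset.sum_congr rfl fun i _ => Finset.sum_congr rfl fun j _ => ?_
    rw [dotProduct_mulVec_symm hs, dotProduct_comm (rotVec x k l) (rotVec x i j)]
  simp only [h1, ← Finset.mul_sum, sum_rotVec_dotProduct_mulVec] at hcs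
  have h2 : ∑ m, (1 : Matrix ι ι ℝ) m ⬝ᵥ (1 : Matrix ι ι ℝ) m = Fintype.card ι := by
    have : ∀ m, (1 : Matrix ι ι ℝ) m ⬝ᵥ (1 : Matrix ι ι ℝ) m = 1 := fun m => by
      simp [dotProduct, Matrix.one_apply]
    simp [this]
  have h3 : tangentialNormSq x (1 : Matrix ι ι ℝ) = (x ⬝ᵥ x) ^ 2 * ((Fintype.card ι : ℝ) - 1) := by
    simp only [tangentialNormSq, h2, one_mulVec]; ring
  rw [h3] at hcs
  have h4 : 0 < 16 * (x ⬝ᵥ x) ^ 2 := by positivity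
  refine le_of_mul_le_mul_left (a := 16 * (x ⬝ᵥ x) ^ 2) ?_ h4
  linarith

/-- The sum of the squares of all second-order rotational derivatives of a function with gradient
`g` and Hessian `h` at `x`. -/
lemma sum_sq_wedge_add_wedge (hs : h.IsSymm) (g : ι → ℝ) :
    ∑ k, ∑ l, ∑ i, ∑ j, ((rotVec x k l i * g j - rotVec x k l j * g i)
        + (x i * (h *ᵥ rotVec x k l) j - x j * (h *ᵥ rotVec x k l) i)) ^ 2
      = 4 * (((Fintype.card ι : ℝ) - 2) * ((x ⬝ᵥ x) * (g ⬝ᵥ g) - (x ⬝ᵥ g) ^ 2)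
        + ((Fintype.card ι : ℝ) - 1) * (x ⬝ᵥ g) ^ 2 + tangentialNormSq x h
        - 2 * (x ⬝ᵥ g) * ((x ⬝ᵥ x) * h.trace - x ⬝ᵥ (h *ᵥ x))) := by
  have e : ∀ k l, ∑ i, ∑ j, ((rotVec x k l i * g j - rotVec x k l j * g i)
        + (x i * (h *ᵥ rotVec x k l) j - x j * (h *ᵥ rotVec x k l) i)) ^ 2
      = 2 * ((rotVec x k l ⬝ᵥ rotVec x k l) * (g ⬝ᵥ g)
          - (rotVec x k l ⬝ᵥ g) * (rotVec x k l ⬝ᵥ g)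
        + ((x ⬝ᵥ x) * ((h *ᵥ rotVec x k l) ⬝ᵥ (h *ᵥ rotVec x k l))
          - (x ⬝ᵥ (h *ᵥ rotVec x k l)) ^ 2)
        - 2 * ((rotVec x k l ⬝ᵥ (h *ᵥ rotVec x k l)) * (x ⬝ᵥ g))) := by
    intro k l
    have h1 := sum_wedge_mul_wedge (rotVec x k l) g (rotVec x k l) g
    have h2 := sum_wedge_mul_wedge x (h *ᵥ rotVec x k l) x (h *ᵥ rotVec x k l)
    have h3 := sum_wedge_mul_wedge (rotVec x k l) g x (h *ᵥ rotVec x k l)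
    rw [dotProduct_comm (rotVec x k l) x, dotProduct_rotVec_self] at h3
    rw [dotProduct_comm g (rotVec x k l)] at h1
    rw [dotProduct_comm g x] at h3
    rw [dotProduct_comm (h *ᵥ rotVec x k l) x] at h2
    have : ∀ A B : ι → ι → ℝ, ∑ i, ∑ j, (A i j + B i j) ^ 2 = ∑ i, ∑ j, A i j * A i j
        + ∑ i, ∑ j, B i j * B i j + 2 * ∑ i, ∑ j, A i j * B i j := by
      intro A B
      simp only [Finset.mul_sum, ← Finset.sum_add_distrib]
      exact Finset.sum_congr rfl fun i _ => Finset.sum_congr rfl fun j _ => by ring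
    rw [this, h1, h2, h3]
    ring
  simp only [e, ← Finset.mul_sum, Finset.sum_sub_distrib, Finset.sum_add_distrib, ← Finset.sum_mul]
  rw [sum_rotVec_dotProduct_self, sum_rotVec_dotProduct_mul, sum_mulVec_rotVec_normSq,
    sum_dotProduct_mulVec_rotVec_sq hs, sum_rotVec_dotProduct_mulVec, tangentialNormSq]
  ring

end

/-! ### Derivatives along vector fields -/

section

variable {F : Type*} [NormedAddCommGroup F] [NormedSpace ℝ F]

/-- The derivative of `u` along the vector field `X`. -/
noncomputable def fieldDeriv (X : F → F) (u : F → ℝ) (x : F) : ℝ := fderiv ℝ u x (X x)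

lemma ContDiff.fieldDeriv {X : F → F} {u : F → ℝ} (hX : ContDiff ℝ ∞ X) (hu : ContDiff ℝ ∞ u) :
    ContDiff ℝ ∞ (fieldDeriv X u) :=
  (hu.fderiv_right (m := ∞) le_rfl).clm_apply hX

lemma fderiv_fieldDeriv {X : F → F} {u : F → ℝ} (hX : ContDiff ℝ ∞ X) (hu : ContDiff ℝ ∞ u)
    (x v : F) : fderiv ℝ (fieldDeriv X u) x v
      = fderiv ℝ (fderiv ℝ u) x v (X x) + fderiv ℝ u x (fderiv ℝ X x v) := by
  have h1 : DifferentiableAt ℝ (fderiv ℝ u) x :=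
    ((hu.fderiv_right (m := ∞) le_rfl).differentiable (by simp)).differentiableAt
  have h2 : DifferentiableAt ℝ X x := (hX.differentiable (by simp)).differentiableAt
  have := fderiv_clm_apply h1 h2
  change fderiv ℝ (fun y => fderiv ℝ u y (X y)) x v = _
  rw [this]
  simp [add_comm]

lemma ContDiff.fderiv_fderiv_comm {u : F → ℝ} (hu : ContDiff ℝ ∞ u) (x v w : F) :
    fderiv ℝ (fderiv ℝ u) x v w = fderiv ℝ (fderiv ℝ u) x w v :=
  (hu.contDiffAt.isSymmSndFDerivAt (by simp; exact WithTop.coe_le_coe.2 le_top)) v w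

/-- The commutator of two vector fields. -/
lemma fieldDeriv_fieldDeriv_sub {X Y : F → F} {u : F → ℝ} (hX : ContDiff ℝ ∞ X)
    (hY : ContDiff ℝ ∞ Y) (hu : ContDiff ℝ ∞ u) (x : F) :
    fieldDeriv X (fieldDeriv Y u) x = fieldDeriv Y (fieldDeriv X u) x
      + (fderiv ℝ u x (fderiv ℝ Y x (X x)) - fderiv ℝ u x (fderiv ℝ X x (Y x))) := by
  have h1 : fieldDeriv X (fieldDeriv Y u) x = _ := fderiv_fieldDeriv hY hu x (X x)
  have h2 : fieldDeriv Y (fieldDeriv X u) x = _ := fderiv_fieldDeriv hX hu x (Y x)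
  rw [h1, h2, hu.fderiv_fderiv_comm]
  ring

lemma fieldDeriv_mul {X : F → F} {u v : F → ℝ} (hu : ContDiff ℝ ∞ u) (hv : ContDiff ℝ ∞ v)
    (x : F) : fieldDeriv X (fun y => u y * v y) x
      = fieldDeriv X u x * v x + u x * fieldDeriv X v x := by
  have h1 := (hu.differentiable (by simp)).differentiableAt (x := x)
  have h2 := (hv.differentiable (by simp)).differentiableAt (x := x)
  simp only [fieldDeriv]
  rw [fderiv_fun_mul h1 h2]
  simp; ring

lemma fieldDeriv_add {X : F → F} {u v : F → ℝ} (hu : ContDiff ℝ ∞ u) (hv : ContDiff ℝ ∞ v)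
    (x : F) : fieldDeriv X (fun y => u y + v y) x = fieldDeriv X u x + fieldDeriv X v x := by
  have h1 := (hu.differentiable (by simp)).differentiableAt (x := x)
  have h2 := (hv.differentiable (by simp)).differentiableAt (x := x)
  simp only [fieldDeriv]
  rw [fderiv_fun_add h1 h2]
  simp

lemma fieldDeriv_sum {ι : Type*} {s : Finset ι} {X : F → F} {u : ι → F → ℝ}
    (hu : ∀ i, ContDiff ℝ ∞ (u i)) (x : F) :
    fieldDeriv X (fun y => ∑ i ∈ s, u i y) x = ∑ i ∈ s, fieldDeriv X (u i) x := by
  simp only [fieldDeriv]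
  rw [fderiv_fun_sum fun i _ => ((hu i).differentiable (by simp)).differentiableAt]
  simp

lemma fieldDeriv_const_mul {X : F → F} {u : F → ℝ} (c : ℝ) (hu : ContDiff ℝ ∞ u) (x : F) :
    fieldDeriv X (fun y => c * u y) x = c * fieldDeriv X u x := by
  simp only [fieldDeriv]
  rw [fderiv_const_mul ((hu.differentiable (by simp)).differentiableAt)]
  simp

/-- The Euler field `x · ∇`. -/
noncomputable def euler (u : F → ℝ) : F → ℝ := fieldDeriv (fun x => x) u

lemma ContDiff.euler {u : F → ℝ} (hu : ContDiff ℝ ∞ u) : ContDiff ℝ ∞ (euler u) :=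
  contDiff_id.fieldDeriv hu

lemma euler_fieldDeriv_clm (B : F →L[ℝ] F) {u : F → ℝ} (hu : ContDiff ℝ ∞ u) :
    euler (fieldDeriv B u) = fieldDeriv B (euler u) := by
  funext x
  have := fieldDeriv_fieldDeriv_sub contDiff_id B.contDiff hu x
  simp only [fderiv_id, B.fderiv, id, ContinuousLinearMap.id_apply, sub_self, add_zero] at this
  exact this

end

section

variable {n : ℕ}

/-- The infinitesimal rotation in the coordinate plane `(i, j)`. -/
noncomputable def rotField (i j : Fin n) :
    EuclideanSpace ℝ (Fin n) →L[ℝ] EuclideanSpace ℝ (Fin n) :=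
  (EuclideanSpace.proj i : EuclideanSpace ℝ (Fin n) →L[ℝ] ℝ).smulRight (EuclideanSpace.single j 1)
    - (EuclideanSpace.proj j : EuclideanSpace ℝ (Fin n) →L[ℝ] ℝ).smulRight
      (EuclideanSpace.single i 1)

lemma rotField_apply (i j : Fin n) (x : EuclideanSpace ℝ (Fin n)) :
    rotField i j x = x i • EuclideanSpace.single j 1 - x j • EuclideanSpace.single i 1 := rfl

lemma ofLp_rotField (i j : Fin n) (x : EuclideanSpace ℝ (Fin n)) :
    (rotField i j x).ofLp = rotVec x.ofLp i j := by
  simp [rotField_apply, rotVec]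

/-- The angular derivative `x_i ∂_j - x_j ∂_i`. -/
noncomputable def angular (i j : Fin n) (u : EuclideanSpace ℝ (Fin n) → ℝ) :
    EuclideanSpace ℝ (Fin n) → ℝ := fieldDeriv (rotField i j) u

/-- The sum of the squares of the angular derivatives, that is, the Laplace-Beltrami operator of
the unit sphere acting in the angular variables. Each coordinate plane is counted twice, whence
the factor `1 / 2`. -/
noncomputable def casimir (u : EuclideanSpace ℝ (Fin n) → ℝ) (x : EuclideanSpace ℝ (Fin n)) : ℝ :=
  1 / 2 * ∑ i, ∑ j, angular i j (angular i j u) x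

/-- The squared length of the gradient in the angular variables. -/
noncomputable def angularNormSq (u : EuclideanSpace ℝ (Fin n) → ℝ)
    (x : EuclideanSpace ℝ (Fin n)) : ℝ := 1 / 2 * ∑ i, ∑ j, angular i j u x ^ 2

/-- The coordinates of the gradient. -/
noncomputable def gradVec (u : EuclideanSpace ℝ (Fin n) → ℝ) (x : EuclideanSpace ℝ (Fin n)) :
    Fin n → ℝ := fun i => fderiv ℝ u x (EuclideanSpace.single i 1)

/-- The Hessian matrix. -/
noncomputable def hessMat (u : EuclideanSpace ℝ (Fin n) → ℝ) (x : EuclideanSpace ℝ (Fin n)) :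
    Matrix (Fin n) (Fin n) ℝ := fun i j =>
  fderiv ℝ (fderiv ℝ u) x (EuclideanSpace.single i 1) (EuclideanSpace.single j 1)

open Matrix

variable {u : EuclideanSpace ℝ (Fin n) → ℝ}

lemma euclidean_eq_sum (v : EuclideanSpace ℝ (Fin n)) :
    v = ∑ i, v i • EuclideanSpace.single i (1 : ℝ) := by
  ext j; simp [Pi.single_apply]

lemma fderiv_apply_eq_dotProduct (x v : EuclideanSpace ℝ (Fin n)) :
    fderiv ℝ u x v = v.ofLp ⬝ᵥ gradVec u x := by
  conv_lhs => rw [euclidean_eq_sum v]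
  simp [dotProduct, gradVec]

lemma fderiv_fderiv_apply_eq_dotProduct (x v w : EuclideanSpace ℝ (Fin n)) :
    fderiv ℝ (fderiv ℝ u) x v w = v.ofLp ⬝ᵥ (hessMat u x *ᵥ w.ofLp) := by
  conv_lhs => rw [euclidean_eq_sum v, euclidean_eq_sum w]
  simp only [map_sum, map_smul, _root_.sum_apply, _root_.smul_apply,
    smul_eq_mul, dotProduct, mulVec, hessMat, Finset.mul_sum]
  rw [Finset.sum_comm]
  exact Finset.sum_congr rfl fun i _ => Finset.sum_congr rfl fun j _ => by ring

lemma isSymm_hessMat (hu : ContDiff ℝ ∞ u) (x : EuclideanSpace ℝ (Fin n)) :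
    (hessMat u x).IsSymm := by
  ext i j
  exact hu.fderiv_fderiv_comm _ _ _

lemma euler_eq (x : EuclideanSpace ℝ (Fin n)) : euler u x = x.ofLp ⬝ᵥ gradVec u x :=
  fderiv_apply_eq_dotProduct x x

lemma euler_euler_eq (hu : ContDiff ℝ ∞ u) (x : EuclideanSpace ℝ (Fin n)) :
    euler (euler u) x = x.ofLp ⬝ᵥ (hessMat u x *ᵥ x.ofLp) + x.ofLp ⬝ᵥ gradVec u x := by
  have h : euler (euler u) x = _ := fderiv_fieldDeriv contDiff_id hu x x
  rw [h]
  rw [fderiv_id, ContinuousLinearMap.id_apply, id, fderiv_fderiv_apply_eq_dotProduct,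
    fderiv_apply_eq_dotProduct]

lemma angular_eq (i j : Fin n) (x : EuclideanSpace ℝ (Fin n)) :
    angular i j u x = x i * gradVec u x j - x j * gradVec u x i := by
  rw [angular, fieldDeriv, fderiv_apply_eq_dotProduct, ofLp_rotField, rotVec_dotProduct]

lemma ContDiff.angular (hu : ContDiff ℝ ∞ u) (i j : Fin n) : ContDiff ℝ ∞ (angular i j u) :=
  (rotField i j).contDiff.fieldDeriv hu

lemma angular_angular_eq (hu : ContDiff ℝ ∞ u) (i j k l : Fin n) (x : EuclideanSpace ℝ (Fin n)) :
    angular k l (angular i j u) x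
      = (rotVec x.ofLp k l i * gradVec u x j - rotVec x.ofLp k l j * gradVec u x i)
        + (x i * (hessMat u x *ᵥ rotVec x.ofLp k l) j
          - x j * (hessMat u x *ᵥ rotVec x.ofLp k l) i) := by
  have h : angular k l (angular i j u) x = _ :=
    fderiv_fieldDeriv (rotField i j).contDiff hu x (rotField k l x)
  rw [h, ContinuousLinearMap.fderiv, fderiv_fderiv_apply_eq_dotProduct, fderiv_apply_eq_dotProduct]
  simp only [ofLp_rotField]
  rw [dotProduct_mulVec_symm (isSymm_hessMat hu x), rotVec_dotProduct, rotVec_dotProduct]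
  ring

lemma angular_euler (hu : ContDiff ℝ ∞ u) (i j : Fin n) :
    angular i j (euler u) = euler (angular i j u) := (euler_fieldDeriv_clm _ hu).symm

lemma casimir_eq (hu : ContDiff ℝ ∞ u) (x : EuclideanSpace ℝ (Fin n)) :
    casimir u x = (x.ofLp ⬝ᵥ x.ofLp) * (hessMat u x).trace - x.ofLp ⬝ᵥ (hessMat u x *ᵥ x.ofLp)
      - ((n : ℝ) - 1) * (x.ofLp ⬝ᵥ gradVec u x) := by
  have h1 : ∀ i j, angular i j (angular i j u) x
      = (rotVec x.ofLp i j i * gradVec u x j - rotVec x.ofLp i j j * gradVec u x i)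
        + rotVec x.ofLp i j ⬝ᵥ (hessMat u x *ᵥ rotVec x.ofLp i j) := fun i j => by
    rw [angular_angular_eq hu, rotVec_dotProduct]
  have h2 : ∑ i, ∑ j, (rotVec x.ofLp i j i * gradVec u x j - rotVec x.ofLp i j j * gradVec u x i)
      = - (2 * (((n : ℝ) - 1) * (x.ofLp ⬝ᵥ gradVec u x))) := by
    have e : ∀ i j, rotVec x.ofLp i j i * gradVec u x j - rotVec x.ofLp i j j * gradVec u x i
        = 2 * (if i = j then x i * gradVec u x i else 0) - x j * gradVec u x j
          - x i * gradVec u x i := by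
      intro i j
      by_cases hij : i = j
      · subst hij; simp [rotVec]; ring
      · simp [rotVec, hij, Ne.symm hij]
    simp only [e, Finset.sum_sub_distrib]
    rw [Finset.sum_comm (f := fun i j => x.ofLp j * gradVec u x j)]
    simp only [← Finset.mul_sum]
    simp only [Finset.sum_ite_eq, Finset.mem_univ, if_true, Finset.sum_const, Finset.card_univ,
      Fintype.card_fin, nsmul_eq_mul, dotProduct, mul_left_comm (x.ofLp _) (n : ℝ)]
    simp only [← Finset.mul_sum]
    ring
  rw [casimir]
  simp only [h1, Finset.sum_add_distrib]
  rw [h2, sum_rotVec_dotProduct_mulVec]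
  ring

lemma laplacian_eq_trace (x : EuclideanSpace ℝ (Fin n)) :
    Laplacian.laplacian u x = (hessMat u x).trace := by
  rw [InnerProductSpace.laplacian_eq_iteratedFDeriv_orthonormalBasis u
    (EuclideanSpace.basisFun (Fin n) ℝ)]
  simp [iteratedFDeriv_two_apply, Matrix.trace, hessMat]

lemma dotProduct_self_eq_norm_sq (x : EuclideanSpace ℝ (Fin n)) :
    x.ofLp ⬝ᵥ x.ofLp = ‖x‖ ^ 2 := by
  rw [EuclideanSpace.real_norm_sq_eq]
  simp [dotProduct, sq]

/-- The Laplacian in polar coordinates. -/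
lemma norm_sq_mul_laplacian (hu : ContDiff ℝ ∞ u) (x : EuclideanSpace ℝ (Fin n)) :
    ‖x‖ ^ 2 * Laplacian.laplacian u x
      = euler (euler u) x + ((n : ℝ) - 2) * euler u x + casimir u x := by
  rw [laplacian_eq_trace, euler_euler_eq hu, euler_eq, casimir_eq hu, dotProduct_self_eq_norm_sq]
  ring

lemma norm_gradient_sq (hu : ContDiff ℝ ∞ u) (x : EuclideanSpace ℝ (Fin n)) :
    ‖gradient u x‖ ^ 2 = gradVec u x ⬝ᵥ gradVec u x := by
  rw [← dotProduct_self_eq_norm_sq]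
  have : (gradient u x).ofLp = gradVec u x := by
    ext i
    have h := ((hu.differentiable (by simp)).differentiableAt
      (x := x)).hasGradientAt.hasFDerivAt.fderiv
    rw [gradVec, h, InnerProductSpace.toDual_apply_apply, EuclideanSpace.inner_single_right]
    simp
  rw [this]

/-- The gradient in polar coordinates. -/
lemma norm_sq_mul_norm_gradient_sq (hu : ContDiff ℝ ∞ u) (x : EuclideanSpace ℝ (Fin n)) :
    ‖x‖ ^ 2 * ‖gradient u x‖ ^ 2 = euler u x ^ 2 + angularNormSq u x := by
  rw [norm_gradient_sq hu, euler_eq, angularNormSq]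
  simp only [angular_eq, sq (_ - _)]
  rw [sum_wedge_mul_wedge, dotProduct_self_eq_norm_sq x, dotProduct_comm (gradVec u x) x.ofLp]
  ring

/-- The pointwise form of the Bochner inequality on spheres: all second-order angular derivatives
control both the Laplace-Beltrami operator, by the Cauchy-Schwarz inequality for the trace of the
tangential Hessian, and the angular gradient, by the curvature of the sphere. -/
lemma casimir_sq_le (hn : 2 ≤ n) (hu : ContDiff ℝ ∞ u) (x : EuclideanSpace ℝ (Fin n)) :
    casimir u x ^ 2 + ((n : ℝ) - 1) * (((n : ℝ) - 2) * angularNormSq u x)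
      ≤ ((n : ℝ) - 1) * (1 / 4 * ∑ k, ∑ l, ∑ i, ∑ j, angular k l (angular i j u) x ^ 2) := by
  have hn' : (2 : ℝ) ≤ n := by exact_mod_cast hn
  have h1 : angularNormSq u x = (x.ofLp ⬝ᵥ x.ofLp) * (gradVec u x ⬝ᵥ gradVec u x)
      - (x.ofLp ⬝ᵥ gradVec u x) ^ 2 := by
    have := norm_sq_mul_norm_gradient_sq hu x
    rw [norm_gradient_sq hu, euler_eq, ← dotProduct_self_eq_norm_sq] at this
    linarith
  simp only [angular_angular_eq hu]
  rw [sum_sq_wedge_add_wedge (isSymm_hessMat hu x), casimir_eq hu, h1]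
  simp only [Fintype.card_fin]
  rcases eq_or_ne (x.ofLp ⬝ᵥ x.ofLp) 0 with h0 | h0
  · have : x.ofLp = 0 := dotProduct_self_eq_zero.1 h0
    simp [this, tangentialNormSq]
  · have := tangential_trace_sq_le (isSymm_hessMat hu x) h0
    simp only [Fintype.card_fin] at this
    nlinarith

lemma ContDiff.casimir (hu : ContDiff ℝ ∞ u) : ContDiff ℝ ∞ (casimir u) :=
  contDiff_const.mul (ContDiff.sum fun i _ => ContDiff.sum fun j _ => (hu.angular i j).angular i j)

lemma ContDiff.angularNormSq (hu : ContDiff ℝ ∞ u) : ContDiff ℝ ∞ (angularNormSq u) :=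
  contDiff_const.mul (ContDiff.sum fun i _ => ContDiff.sum fun j _ => (hu.angular i j).pow 2)

lemma laplacian_eq_sum_fieldDeriv (hu : ContDiff ℝ ∞ u) : Laplacian.laplacian u = fun x =>
    ∑ k, fieldDeriv (fun _ => EuclideanSpace.single k (1 : ℝ))
      (fieldDeriv (fun _ => EuclideanSpace.single k (1 : ℝ)) u) x := by
  funext x
  rw [laplacian_eq_trace, Matrix.trace]
  refine Finset.sum_congr rfl fun k _ => ?_
  have := fderiv_fieldDeriv (X := fun _ => EuclideanSpace.single k (1 : ℝ)) contDiff_const hu x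
    (EuclideanSpace.single k 1)
  refine Eq.trans ?_ this.symm
  simp [hessMat]

lemma ContDiff.laplacian (hu : ContDiff ℝ ∞ u) : ContDiff ℝ ∞ (Laplacian.laplacian u) := by
  rw [laplacian_eq_sum_fieldDeriv hu]
  exact ContDiff.sum fun k _ => contDiff_const.fieldDeriv (contDiff_const.fieldDeriv hu)

lemma angular_laplacian (hu : ContDiff ℝ ∞ u) (i j : Fin n) (x : EuclideanSpace ℝ (Fin n)) :
    angular i j (Laplacian.laplacian u) x = Laplacian.laplacian (angular i j u) x := by
  set e : Fin n → EuclideanSpace ℝ (Fin n) := fun k => EuclideanSpace.single k 1 with he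
  have hc : ∀ v : EuclideanSpace ℝ (Fin n), ContDiff ℝ ∞ (fieldDeriv (fun _ => v) u) :=
    fun v => contDiff_const.fieldDeriv hu
  have hJ := (rotField i j).contDiff (n := ∞)
  have hcomm : ∀ (w : EuclideanSpace ℝ (Fin n) → ℝ), ContDiff ℝ ∞ w → ∀ k,
      fieldDeriv (fun _ => e k) (angular i j w)
        = fun y => angular i j (fieldDeriv (fun _ => e k) w) y
          + fieldDeriv (fun _ => rotField i j (e k)) w y := by
    intro w hw k
    funext y
    have := fieldDeriv_fieldDeriv_sub (X := fun _ => e k) contDiff_const hJ hw y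
    simp only [ContinuousLinearMap.fderiv, fderiv_fun_const, Pi.zero_apply,
      _root_.zero_apply, map_zero, sub_zero] at this
    exact this
  have hsecond : ∀ v w : EuclideanSpace ℝ (Fin n), fieldDeriv (fun _ => v)
      (fieldDeriv (fun _ => w) u) x = fderiv ℝ (fderiv ℝ u) x v w := by
    intro v w
    have := fderiv_fieldDeriv (X := fun _ => w) contDiff_const hu x v
    refine Eq.trans this ?_
    simp
  rw [laplacian_eq_sum_fieldDeriv (hu.angular i j), laplacian_eq_sum_fieldDeriv hu, angular,
    fieldDeriv_sum fun k => contDiff_const.fieldDeriv (hc _)]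
  have hk : ∀ k, fieldDeriv (fun _ => e k) (fieldDeriv (fun _ => e k) (angular i j u)) x
      = fieldDeriv (rotField i j) (fieldDeriv (fun _ => e k) (fieldDeriv (fun _ => e k) u)) x
        + 2 * fderiv ℝ (fderiv ℝ u) x (e k) (rotField i j (e k)) := by
    intro k
    rw [hcomm u hu k, fieldDeriv_add ((hc _).angular i j) (hc _), hcomm _ (hc _) k, hsecond]
    beta_reduce
    rw [hsecond, hu.fderiv_fderiv_comm x (rotField i j (e k))]
    simp only [angular]
    ring
  have hzero : ∑ k, fderiv ℝ (fderiv ℝ u) x (e k) (rotField i j (e k)) = 0 := by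
    have : ∀ k, fderiv ℝ (fderiv ℝ u) x (e k) (rotField i j (e k))
        = (if i = k then fderiv ℝ (fderiv ℝ u) x (e k) (e j) else 0)
          - (if j = k then fderiv ℝ (fderiv ℝ u) x (e k) (e i) else 0) := by
      intro k
      rw [rotField_apply, map_sub, map_smul, map_smul]
      simp only [he, PiLp.single_apply]
      split_ifs <;> simp
    simp only [this, Finset.sum_sub_distrib, Finset.sum_ite_eq, Finset.mem_univ, if_true]
    rw [hu.fderiv_fderiv_comm]; ring
  simp only [he] at hk hzero
  simp only [hk, Finset.sum_add_distrib, ← Finset.mul_sum, hzero]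
  ring

/-- Rotations commute with the Laplace-Beltrami operator. -/
lemma angular_casimir (hu : ContDiff ℝ ∞ u) (i j : Fin n) (x : EuclideanSpace ℝ (Fin n)) :
    angular i j (casimir u) x = casimir (angular i j u) x := by
  have h1 : casimir u = fun x => (‖x‖ ^ 2 * Laplacian.laplacian u x
      + ((-1) * euler (euler u) x + (-((n : ℝ) - 2)) * euler u x)) := by
    funext x
    have := norm_sq_mul_laplacian hu x
    linarith
  have hN : ContDiff ℝ ∞ fun x : EuclideanSpace ℝ (Fin n) => ‖x‖ ^ 2 := contDiff_norm_sq ℝ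
  have hE := hu.euler
  have hEE := hE.euler
  have hL := hu.laplacian
  have hN0 : fieldDeriv (rotField i j) (fun x : EuclideanSpace ℝ (Fin n) => ‖x‖ ^ 2) x = 0 := by
    rw [fieldDeriv, fderiv_norm_sq_apply]
    simp [rotField_apply, inner_sub_right, inner_smul_right, EuclideanSpace.inner_single_right,
      mul_comm]
  have h2 := norm_sq_mul_laplacian (hu.angular i j) x
  rw [h1]
  rw [angular, fieldDeriv_add (hN.mul hL) ((contDiff_const.mul hEE).add (contDiff_const.mul hE)),
    fieldDeriv_add (contDiff_const.mul hEE) (contDiff_const.mul hE),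
    fieldDeriv_const_mul _ hEE, fieldDeriv_const_mul _ hE, fieldDeriv_mul hN hL, hN0]
  have h3 : fieldDeriv (rotField i j) (Laplacian.laplacian u) x = _ := angular_laplacian hu i j x
  have h4 : fieldDeriv (rotField i j) (euler u) = _ := angular_euler hu i j
  have h5 : fieldDeriv (rotField i j) (euler (euler u)) = _ := angular_euler hE i j
  rw [h3, h4, h5, angular_euler hu]
  linarith

end

/-! ### Integration over orbits of rotations -/

section

variable {F : Type*} [NormedAddCommGroup F] [InnerProductSpace ℝ F]

/-- The one-parameter group `exp (t J)` of a skew-symmetric `J` with `J³ = -J`. -/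
noncomputable def rotFlow (J : F →L[ℝ] F) (t : ℝ) : F →L[ℝ] F :=
  ContinuousLinearMap.id ℝ F + (1 - Real.cos t) • (J ∘L J) + Real.sin t • J

variable {J : F →L[ℝ] F}

lemma rotFlow_apply (t : ℝ) (x : F) :
    rotFlow J t x = x + (1 - Real.cos t) • J (J x) + Real.sin t • J x := rfl

lemma rotFlow_zero (x : F) : rotFlow J 0 x = x := by simp [rotFlow_apply]

lemma rotFlow_two_pi (x : F) : rotFlow J (2 * Real.pi) x = x := by simp [rotFlow_apply]

lemma hasDerivAt_rotFlow (hJ : ∀ x, J (J (J x)) = -J x) (t : ℝ) (x : F) :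
    HasDerivAt (fun t => rotFlow J t x) (J (rotFlow J t x)) t := by
  have h1 : HasDerivAt (fun t => (1 - Real.cos t) • J (J x)) (Real.sin t • J (J x)) t := by
    simpa using (((Real.hasDerivAt_cos t).const_sub 1).smul_const (J (J x)))
  have h2 : HasDerivAt (fun t => Real.sin t • J x) (Real.cos t • J x) t :=
    (Real.hasDerivAt_sin t).smul_const (J x)
  refine ((h1.const_add x).add h2).congr_deriv ?_
  simp only [rotFlow_apply, map_add, map_smul, hJ]
  module

lemma inner_skew (hJ : ∀ x, inner ℝ (J x) x = 0) (x y : F) :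
    inner ℝ (J x) y = -inner ℝ x (J y) := by
  have := hJ (x + y)
  simp only [map_add, inner_add_left, inner_add_right, hJ] at this
  rw [real_inner_comm (J y) x]
  linarith

lemma norm_rotFlow (hJ : ∀ x, J (J (J x)) = -J x) (hskew : ∀ x, inner ℝ (J x) x = 0) (t : ℝ)
    (x : F) : ‖rotFlow J t x‖ = ‖x‖ := by
  rw [← sq_eq_sq₀ (norm_nonneg _) (norm_nonneg _), ← real_inner_self_eq_norm_sq,
    ← real_inner_self_eq_norm_sq, rotFlow_apply]
  have h1 : inner ℝ x (J x) = 0 := by rw [real_inner_comm]; exact hskew x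
  have h2 : inner ℝ (J (J x)) x = -inner ℝ (J x) (J x) := inner_skew hskew _ _
  have h3 : inner ℝ x (J (J x)) = -inner ℝ (J x) (J x) := by rw [real_inner_comm]; exact h2
  have h4 : inner ℝ (J (J x)) (J (J x)) = inner ℝ (J x) (J x) := by
    rw [inner_skew hskew, hJ]; simp
  have h5 : inner ℝ (J (J x)) (J x) = 0 := hskew _
  have h6 : inner ℝ (J x) (J (J x)) = 0 := by rw [real_inner_comm]; exact h5
  simp only [inner_add_left, inner_add_right, inner_smul_left, inner_smul_right, h1, h2, h3, h4, h5,
    h6, hskew x, RCLike.conj_to_real]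
  have := Real.sin_sq_add_cos_sq t
  linear_combination (inner ℝ (J x) (J x)) * this

lemma hasDerivAt_comp_rotFlow (hJ : ∀ x, J (J (J x)) = -J x) {u : F → ℝ} (hu : ContDiff ℝ ∞ u)
    (t : ℝ) (x : F) :
    HasDerivAt (fun t => u (rotFlow J t x)) (fieldDeriv J u (rotFlow J t x)) t :=
  ((hu.differentiable (by simp)).differentiableAt.hasFDerivAt).comp_hasDerivAt t
    (hasDerivAt_rotFlow hJ t x)

lemma continuous_rotFlow_apply (x : F) : Continuous fun t => rotFlow J t x := by
  simp only [rotFlow_apply]; fun_prop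

variable [FiniteDimensional ℝ F] [MeasurableSpace F] [BorelSpace F] {μ : Measure F}
  [IsFiniteMeasure μ] {b : ℝ}

lemma Continuous.integrable_of_ae_norm_le (hb : ∀ᵐ x ∂μ, ‖x‖ ≤ b) {G : F → ℝ}
    (hG : Continuous G) : Integrable G μ := by
  obtain ⟨C, hC⟩ := (isCompact_closedBall (0 : F) b).exists_bound_of_continuousOn hG.continuousOn
  refine Integrable.of_bound hG.aestronglyMeasurable C ?_
  filter_upwards [hb] with x hx using hC x (by simpa using hx)

/-- A rotation-invariant measure can be averaged over the orbits of a group of rotations. -/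
lemma integral_nonneg_of_orbit (hμ : ∀ A : F ≃ₗᵢ[ℝ] F, MeasurePreserving A μ μ)
    (hb : ∀ᵐ x ∂μ, ‖x‖ ≤ b) (hJ : ∀ x, J (J (J x)) = -J x) (hskew : ∀ x, inner ℝ (J x) x = 0)
    {G : F → ℝ} (hG : Continuous G)
    (h : ∀ x, 0 ≤ ∫ t in (0 : ℝ)..2 * Real.pi, G (rotFlow J t x)) : 0 ≤ ∫ x, G x ∂μ := by
  obtain ⟨C, hC⟩ := (isCompact_closedBall (0 : F) b).exists_bound_of_continuousOn hG.continuousOn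
  have hcont : Continuous fun p : ℝ × F => G (rotFlow J p.1 p.2) := by
    simp only [rotFlow_apply]
    fun_prop
  have hint : Integrable (fun p : ℝ × F => G (rotFlow J p.1 p.2))
      ((volume.restrict (Ioc 0 (2 * Real.pi))).prod μ) := by
    refine Integrable.of_bound hcont.aestronglyMeasurable C ?_
    filter_upwards [Measure.quasiMeasurePreserving_snd.ae hb] with p hp
    exact hC _ (by simpa [norm_rotFlow hJ hskew] using hp)
  have hswap := integral_integral_swap (f := fun t x => G (rotFlow J t x)) hint
  have hrot : ∀ t, ∫ x, G (rotFlow J t x) ∂μ = ∫ x, G x ∂μ := by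
    intro t
    let A : F ≃ₗᵢ[ℝ] F := LinearIsometry.toLinearIsometryEquiv
      ⟨(rotFlow J t).toLinearMap, norm_rotFlow hJ hskew t⟩ rfl
    have := (hμ A).integral_comp A.toHomeomorph.measurableEmbedding G
    exact this
  simp only [hrot] at hswap
  rw [integral_const] at hswap
  have h2 : 0 ≤ ∫ x, (∫ t in Ioc 0 (2 * Real.pi), G (rotFlow J t x)) ∂μ := by
    refine integral_nonneg fun x => ?_
    have := h x
    rwa [intervalIntegral.integral_of_le Real.two_pi_pos.le] at this
  rw [← hswap] at h2
  have h3 : (0 : ℝ) < (volume.restrict (Ioc 0 (2 * Real.pi))).real univ := by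
    simp [Measure.real, ENNReal.toReal_ofReal Real.pi_pos.le, Real.pi_pos]
  exact nonneg_of_mul_nonneg_right (by simpa using h2) h3

lemma integral_fieldDeriv_eq_zero (hμ : ∀ A : F ≃ₗᵢ[ℝ] F, MeasurePreserving A μ μ)
    (hb : ∀ᵐ x ∂μ, ‖x‖ ≤ b) (hJ : ∀ x, J (J (J x)) = -J x) (hskew : ∀ x, inner ℝ (J x) x = 0)
    {u : F → ℝ} (hu : ContDiff ℝ ∞ u) : ∫ x, fieldDeriv J u x ∂μ = 0 := by
  have hc := (J.contDiff.fieldDeriv hu).continuous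
  have h0 : ∀ x, ∫ t in (0 : ℝ)..2 * Real.pi, fieldDeriv J u (rotFlow J t x) = 0 := by
    intro x
    rw [intervalIntegral.integral_eq_sub_of_hasDerivAt
      (fun t _ => hasDerivAt_comp_rotFlow hJ hu t x)
      ((hc.comp (continuous_rotFlow_apply x)).intervalIntegrable _ _), rotFlow_two_pi,
      rotFlow_zero, sub_self]
  have h1 := integral_nonneg_of_orbit hμ hb hJ hskew hc fun x => (h0 x).ge
  have h2 := integral_nonneg_of_orbit hμ hb hJ hskew (G := fun x => -fieldDeriv J u x) hc.neg
    fun x => by rw [intervalIntegral.integral_neg, h0, neg_zero]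
  rw [integral_neg] at h2
  linarith

/-- Wirtinger's inequality, integrated over the orbits of a group of rotations. -/
lemma integral_fieldDeriv_sq_le (hμ : ∀ A : F ≃ₗᵢ[ℝ] F, MeasurePreserving A μ μ)
    (hb : ∀ᵐ x ∂μ, ‖x‖ ≤ b) (hJ : ∀ x, J (J (J x)) = -J x) (hskew : ∀ x, inner ℝ (J x) x = 0)
    {u : F → ℝ} (hu : ContDiff ℝ ∞ u) :
    ∫ x, fieldDeriv J u x ^ 2 ∂μ ≤ ∫ x, fieldDeriv J (fieldDeriv J u) x ^ 2 ∂μ := by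
  have hu₁ := J.contDiff.fieldDeriv hu
  have hu₂ := J.contDiff.fieldDeriv hu₁
  have hc₁ := hu₁.continuous
  have hc₂ := hu₂.continuous
  have := integral_nonneg_of_orbit hμ hb hJ hskew
    (G := fun x => fieldDeriv J (fieldDeriv J u) x ^ 2 - fieldDeriv J u x ^ 2)
    ((hc₂.pow 2).sub (hc₁.pow 2)) ?_
  · have e := integral_sub ((hc₂.pow 2).integrable_of_ae_norm_le hb)
      ((hc₁.pow 2).integrable_of_ae_norm_le hb)
    exact sub_nonneg.1 (this.trans_eq e)
  · intro x
    have hr := continuous_rotFlow_apply (J := J) x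
    have := integral_sq_deriv_le_integral_sq_deriv_deriv
      (fun t => hasDerivAt_comp_rotFlow hJ hu t x) (fun t => hasDerivAt_comp_rotFlow hJ hu₁ t x)
      (hc₂.comp hr) (by rw [rotFlow_two_pi, rotFlow_zero]) (by rw [rotFlow_two_pi, rotFlow_zero])
    exact (sub_nonneg.2 this).trans_eq (intervalIntegral.integral_sub
      (((hc₂.pow 2).comp hr).intervalIntegrable _ _)
      (((hc₁.pow 2).comp hr).intervalIntegrable _ _)).symm

end

section

variable {n : ℕ}

lemma rotField_cube (i j : Fin n) (x : EuclideanSpace ℝ (Fin n)) :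
    rotField i j (rotField i j (rotField i j x)) = -rotField i j x := by
  rcases eq_or_ne i j with rfl | h
  · simp [rotField_apply]
  · simp only [rotField_apply, PiLp.sub_apply, PiLp.smul_apply, PiLp.single_apply, h, h.symm,
      if_true, if_false, smul_eq_mul]
    module

lemma inner_rotField_self (i j : Fin n) (x : EuclideanSpace ℝ (Fin n)) :
    inner ℝ (rotField i j x) x = 0 := by
  simp [rotField_apply, inner_sub_left, inner_smul_left, EuclideanSpace.inner_single_left, mul_comm]

variable {μ : Measure (EuclideanSpace ℝ (Fin n))} [IsFiniteMeasure μ] {b : ℝ}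
  {u v : EuclideanSpace ℝ (Fin n) → ℝ}

/-- Integration by parts for the Laplace-Beltrami operator. -/
lemma integral_mul_casimir
    (hμ : ∀ A : EuclideanSpace ℝ (Fin n) ≃ₗᵢ[ℝ] EuclideanSpace ℝ (Fin n), MeasurePreserving A μ μ)
    (hb : ∀ᵐ x ∂μ, ‖x‖ ≤ b) (hu : ContDiff ℝ ∞ u) (hv : ContDiff ℝ ∞ v) :
    ∫ x, v x * casimir u x ∂μ
      = -(1 / 2 * ∑ i, ∑ j, ∫ x, angular i j v x * angular i j u x ∂μ) := by
  have h0 : ∀ i j, ∫ x, angular i j v x * angular i j u x ∂μ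
      = -∫ x, v x * angular i j (angular i j u) x ∂μ := by
    intro i j
    have := integral_fieldDeriv_eq_zero hμ hb (rotField_cube i j) (inner_rotField_self i j)
      (hv.mul (hu.angular i j))
    simp only [fieldDeriv_mul hv (hu.angular i j)] at this
    have e := integral_add
      (((hv.angular i j).mul (hu.angular i j)).continuous.integrable_of_ae_norm_le hb)
      ((hv.mul ((hu.angular i j).angular i j)).continuous.integrable_of_ae_norm_le hb)
    have e' := e.symm.trans this
    linarith
  have h1 : ∀ x, v x * casimir u x
      = 1 / 2 * ∑ i, ∑ j, v x * angular i j (angular i j u) x := by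
    intro x
    simp only [casimir, Finset.mul_sum]
    exact Finset.sum_congr rfl fun i _ => Finset.sum_congr rfl fun j _ => by ring
  simp only [h1, h0]
  rw [integral_const_mul, integral_finsetSum _ fun i _ => ?_]
  · rw [Finset.sum_congr rfl fun i _ => integral_finsetSum _ fun j _ => ?_]
    · simp only [Finset.sum_neg_distrib, mul_neg, neg_neg]
    · exact (hv.mul ((hu.angular i j).angular i j)).continuous.integrable_of_ae_norm_le hb
  · exact (ContDiff.sum fun j _ =>
      hv.mul ((hu.angular i j).angular i j)).continuous.integrable_of_ae_norm_le hb

/-- Bochner's formula, in integrated form. It is immediate from the fact that the angular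
derivatives commute with the Laplace-Beltrami operator. -/
lemma integral_casimir_sq
    (hμ : ∀ A : EuclideanSpace ℝ (Fin n) ≃ₗᵢ[ℝ] EuclideanSpace ℝ (Fin n), MeasurePreserving A μ μ)
    (hb : ∀ᵐ x ∂μ, ‖x‖ ≤ b) (hu : ContDiff ℝ ∞ u) :
    ∫ x, casimir u x ^ 2 ∂μ
      = ∫ x, 1 / 4 * ∑ k, ∑ l, ∑ i, ∑ j, angular k l (angular i j u) x ^ 2 ∂μ := by
  simp only [sq (casimir u _)]
  rw [integral_mul_casimir hμ hb hu hu.casimir]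
  have h1 : ∀ i j, ∫ x, angular i j (casimir u) x * angular i j u x ∂μ
      = -(1 / 2 * ∑ k, ∑ l, ∫ x, angular k l (angular i j u) x ^ 2 ∂μ) := by
    intro i j
    simp only [angular_casimir hu, mul_comm (casimir _ _)]
    rw [integral_mul_casimir hμ hb (hu.angular i j) (hu.angular i j)]
    simp only [sq]
  simp only [h1]
  have hI : ∀ i j k l, Integrable (fun x => angular k l (angular i j u) x ^ 2) μ := fun i j k l =>
    (((hu.angular i j).angular k l).pow 2).continuous.integrable_of_ae_norm_le hb
  rw [integral_const_mul, integral_finsetSum _ fun k _ => integrable_finsetSum _ fun l _ =>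
    integrable_finsetSum _ fun i _ => integrable_finsetSum _ fun j _ => hI i j k l]
  rw [Finset.sum_congr rfl fun k _ => integral_finsetSum _ fun l _ =>
    integrable_finsetSum _ fun i _ => integrable_finsetSum _ fun j _ => hI i j k l]
  rw [Finset.sum_congr rfl fun k _ => Finset.sum_congr rfl fun l _ =>
    integral_finsetSum _ fun i _ =>
    integrable_finsetSum _ fun j _ => hI i j k l]
  rw [Finset.sum_congr rfl fun k _ => Finset.sum_congr rfl fun l _ =>
    Finset.sum_congr rfl fun i _ =>
    integral_finsetSum _ fun j _ => hI i j k l]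
  simp only [Finset.sum_neg_distrib, ← Finset.mul_sum]
  have hcomm : ∑ i, ∑ j, ∑ k, ∑ l, ∫ x, angular k l (angular i j u) x ^ 2 ∂μ
      = ∑ k, ∑ l, ∑ i, ∑ j, ∫ x, angular k l (angular i j u) x ^ 2 ∂μ := by
    have e : ∀ f : Fin n → Fin n → Fin n → Fin n → ℝ,
        ∑ i, ∑ j, ∑ k, ∑ l, f i j k l = ∑ k, ∑ l, ∑ i, ∑ j, f i j k l := by
      intro f
      have := Finset.sum_comm (s := (Finset.univ : Finset (Fin n × Fin n)))
        (t := (Finset.univ : Finset (Fin n × Fin n))) (f := fun p q => f p.1 p.2 q.1 q.2)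
      simpa only [Fintype.sum_prod_type] using this
    exact e _
  rw [hcomm]
  ring

/-- The first nonzero eigenvalue of the Laplace-Beltrami operator of the unit sphere is `n - 1`.
For `n ≥ 3` this is Lichnerowicz's argument; on the circle, where the curvature gives nothing, it
is Wirtinger's inequality. -/
lemma integral_angularNormSq_le (hn : 1 ≤ n)
    (hμ : ∀ A : EuclideanSpace ℝ (Fin n) ≃ₗᵢ[ℝ] EuclideanSpace ℝ (Fin n), MeasurePreserving A μ μ)
    (hb : ∀ᵐ x ∂μ, ‖x‖ ≤ b) (hu : ContDiff ℝ ∞ u) :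
    ((n : ℝ) - 1) * ∫ x, angularNormSq u x ∂μ ≤ ∫ x, casimir u x ^ 2 ∂μ := by
  obtain rfl | rfl | h3 : n = 1 ∨ n = 2 ∨ 3 ≤ n := by omega
  · simp only [Nat.cast_one, sub_self, zero_mul]
    exact integral_nonneg fun x => sq_nonneg _
  · have h := integral_fieldDeriv_sq_le hμ hb (rotField_cube 0 1) (inner_rotField_self 0 1) hu
    have hneg : rotField (n := 2) 1 0 = -rotField 0 1 := by
      ext x; simp [rotField_apply]
    have hself : ∀ i, rotField (n := 2) i i = 0 := fun i => by
      ext x; simp [rotField_apply]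
    have h1 : ∀ x, angularNormSq u x = fieldDeriv (rotField 0 1) u x ^ 2 := by
      intro x
      simp [angularNormSq, Fin.sum_univ_two, angular, hneg, hself, fieldDeriv]
      ring
    have h10 : angular 1 0 u = fun x => (-1) * angular 0 1 u x := by
      funext x; simp [angular, hneg, fieldDeriv]
    have h2 : ∀ x, casimir u x = fieldDeriv (rotField 0 1) (fieldDeriv (rotField 0 1) u) x := by
      intro x
      have e1 : angular 1 0 (angular 1 0 u) x
          = fieldDeriv (rotField 0 1) (fieldDeriv (rotField 0 1) u) x := by
        rw [h10]
        have : angular 1 0 (fun x => (-1) * angular 0 1 u x) x = _ :=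
          fieldDeriv_const_mul (-1) (hu.angular 0 1) x
        rw [this]
        simp [fieldDeriv, hneg, angular]
      have e2 : ∀ i, ∀ w : EuclideanSpace ℝ (Fin 2) → ℝ, angular i i w x = 0 := by
        intro i w; simp [angular, fieldDeriv, hself]
      simp only [casimir, Fin.sum_univ_two, e1, e2]
      simp only [angular]
      ring
    simp only [h1, h2]
    norm_num
    exact h
  · have hn' : (3 : ℝ) ≤ n := by exact_mod_cast h3
    have hI1 := hu.angularNormSq.continuous.integrable_of_ae_norm_le hb
    have hI2 := (hu.casimir.pow 2).continuous.integrable_of_ae_norm_le hb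
    have hI3 : Integrable (fun x => 1 / 4 * ∑ k, ∑ l, ∑ i, ∑ j,
        angular k l (angular i j u) x ^ 2) μ := by
      refine Continuous.integrable_of_ae_norm_le hb (ContDiff.continuous (𝕜 := ℝ) (n := ∞) ?_)
      exact contDiff_const.mul (ContDiff.sum fun k _ => ContDiff.sum fun l _ => ContDiff.sum
        fun i _ => ContDiff.sum fun j _ => ((hu.angular i j).angular k l).pow 2)
    have h := integral_mono (hI2.add ((hI1.const_mul _).const_mul _)) (hI3.const_mul _)
      (casimir_sq_le (by omega) hu)
    have e : ∫ x, (casimir u x ^ 2 + ((n : ℝ) - 1) * (((n : ℝ) - 2) * angularNormSq u x)) ∂μ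
        = ∫ x, casimir u x ^ 2 ∂μ
          + ((n : ℝ) - 1) * (((n : ℝ) - 2) * ∫ x, angularNormSq u x ∂μ) := by
      rw [integral_add hI2 ((hI1.const_mul _).const_mul _), integral_const_mul, integral_const_mul]
    have h' := e.symm.le.trans h
    rw [integral_const_mul, ← integral_casimir_sq hμ hb hu] at h'
    nlinarith

end

/-! ### Integration over annuli -/

section

variable {n : ℕ}

/-- The open annulus `a < |x| < b`. -/
def annulus (n : ℕ) (a b : ℝ) : Set (EuclideanSpace ℝ (Fin n)) := {x | a < ‖x‖ ∧ ‖x‖ < b}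

lemma isOpen_annulus (a b : ℝ) : IsOpen (annulus n a b) :=
  (isOpen_lt continuous_const continuous_norm).inter (isOpen_lt continuous_norm continuous_const)

lemma integrableOn_annulus {a b : ℝ} {w : ℝ → ℝ} (hw : ContinuousOn w (Icc a b))
    {G : EuclideanSpace ℝ (Fin n) → ℝ} (hG : Continuous G) :
    IntegrableOn (fun x => w ‖x‖ * G x) (annulus n a b) := by
  have hK : IsCompact {x : EuclideanSpace ℝ (Fin n) | a ≤ ‖x‖ ∧ ‖x‖ ≤ b} := by
    refine (isCompact_closedBall (0 : EuclideanSpace ℝ (Fin n)) b).of_isClosed_subset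
      ((isClosed_le continuous_const continuous_norm).inter
        (isClosed_le continuous_norm continuous_const)) fun x hx => by simpa using hx.2
  have hc : ContinuousOn (fun x => w ‖x‖ * G x)
      {x : EuclideanSpace ℝ (Fin n) | a ≤ ‖x‖ ∧ ‖x‖ ≤ b} :=
    (hw.comp continuous_norm.continuousOn fun x hx => hx).mul hG.continuousOn
  exact (hc.integrableOn_compact hK).mono_set fun x hx => ⟨hx.1.le, hx.2.le⟩

/-- The inequality between the terms with angular derivatives: integration by parts in the angular
variables, and the spectral gap of the sphere, against a radial weight. -/
lemma setIntegral_annulus_angular_nonneg (hn : 1 ≤ n) {a b : ℝ} {w : ℝ → ℝ}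
    (hw : ContinuousOn w (Icc a b)) (hw0 : ∀ r ∈ Icc a b, 0 ≤ w r)
    {u f : EuclideanSpace ℝ (Fin n) → ℝ} (hu : ContDiff ℝ ∞ u) (hf : ContDiff ℝ ∞ f) :
    0 ≤ ∫ x in annulus n a b, w ‖x‖ * (2 * (f x * casimir u x) + casimir u x ^ 2
      + ∑ i, ∑ j, angular i j f x * angular i j u x - ((n : ℝ) - 1) * angularNormSq u x) := by
  have hmeas := (isOpen_annulus (n := n) a b).measurableSet
  have hwint := integrableOn_annulus (n := n) hw (G := fun _ => 1) continuous_const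
  simp only [mul_one] at hwint
  set A := annulus n a b with hA
  set d : EuclideanSpace ℝ (Fin n) → ENNReal := fun x => ENNReal.ofReal (w ‖x‖) with hd
  set μ : Measure (EuclideanSpace ℝ (Fin n)) := (volume.restrict A).withDensity d with hμdef
  have hfin : IsFiniteMeasure μ := isFiniteMeasure_withDensity_ofReal hwint.2
  have hdm : AEMeasurable d (volume.restrict A) :=
    hwint.aestronglyMeasurable.aemeasurable.ennreal_ofReal
  have hb : ∀ᵐ x ∂μ, ‖x‖ ≤ b := by
    have : ∀ᵐ x ∂(volume.restrict A), ‖x‖ ≤ b := by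
      filter_upwards [ae_restrict_mem hmeas] with x hx using hx.2.le
    exact (withDensity_absolutelyContinuous _ _).ae_le this
  have hμ : ∀ B : EuclideanSpace ℝ (Fin n) ≃ₗᵢ[ℝ] EuclideanSpace ℝ (Fin n),
      MeasurePreserving B μ μ := by
    intro B
    refine ⟨B.continuous.measurable, ?_⟩
    ext s hs
    have hBs : MeasurableSet (B ⁻¹' s) := B.continuous.measurable hs
    rw [Measure.map_apply B.continuous.measurable hs, withDensity_apply _ hBs,
      withDensity_apply _ hs, Measure.restrict_restrict hBs, Measure.restrict_restrict hs]
    have hpre : B ⁻¹' s ∩ A = B ⁻¹' (s ∩ A) := by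
      ext x; simp [hA, annulus]
    rw [hpre, ← B.measurePreserving.setLIntegral_comp_preimage_emb
      B.toHomeomorph.measurableEmbedding d (s ∩ A)]
    simp only [hd, LinearIsometryEquiv.norm_map]
  have hint : ∀ G : EuclideanSpace ℝ (Fin n) → ℝ,
      ∫ x, G x ∂μ = ∫ x in A, w ‖x‖ * G x := by
    intro G
    rw [hμdef, integral_withDensity_eq_integral_toReal_smul₀ hdm (by simp [hd])]
    refine setIntegral_congr_fun hmeas fun x hx => ?_
    simp only [hd, smul_eq_mul]
    rw [ENNReal.toReal_ofReal (hw0 _ ⟨hx.1.le, hx.2.le⟩)]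
  rw [← hint]
  have hI : ∀ {G : EuclideanSpace ℝ (Fin n) → ℝ}, ContDiff ℝ ∞ G → Integrable G μ :=
    fun hG => hG.continuous.integrable_of_ae_norm_le hb
  have h1 := integral_mul_casimir hμ hb hu hf
  have h2 := integral_angularNormSq_le hn hμ hb hu
  have hS : ContDiff ℝ ∞ fun x => ∑ i, ∑ j, angular i j f x * angular i j u x :=
    ContDiff.sum fun i _ => ContDiff.sum fun j _ => (hf.angular i j).mul (hu.angular i j)
  have hfc : ContDiff ℝ ∞ fun x => 2 * (f x * casimir u x) := contDiff_const.mul (hf.mul hu.casimir)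
  have hcc : ContDiff ℝ ∞ fun x => casimir u x ^ 2 := hu.casimir.pow 2
  have h3 : ∫ x, ∑ i, ∑ j, angular i j f x * angular i j u x ∂μ
      = ∑ i, ∑ j, ∫ x, angular i j f x * angular i j u x ∂μ := by
    rw [integral_finsetSum _ fun i _ => integrable_finsetSum _ fun j _ =>
      hI ((hf.angular i j).mul (hu.angular i j))]
    exact Finset.sum_congr rfl fun i _ => integral_finsetSum _ fun j _ =>
      hI ((hf.angular i j).mul (hu.angular i j))
  rw [integral_sub (hI ((hfc.add hcc).add hS)) (hI (contDiff_const.mul hu.angularNormSq)),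
    integral_add (hI (hfc.add hcc)) (hI hS), integral_add (hI hfc) (hI hcc), integral_const_mul,
    integral_const_mul, h1, h3]
  linarith

/-- A lower bound, ray by ray, of an integral over an annulus. -/
lemma mul_toSphere_le_setIntegral_annulus {a b c : ℝ} (ha : 0 ≤ a) (hab : a ≤ b)
    {G : EuclideanSpace ℝ (Fin n) → ℝ} (hG : IntegrableOn G (annulus n a b))
    (h : ∀ θ : EuclideanSpace ℝ (Fin n), ‖θ‖ = 1 → c ≤ ∫ r in a..b, r ^ (n - 1) * G (r • θ)) :
    c * (volume : Measure (EuclideanSpace ℝ (Fin n))).toSphere.real univ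
      ≤ ∫ x in annulus n a b, G x := by
  set ν := (volume : Measure (EuclideanSpace ℝ (Fin n))).toSphere
  set g : EuclideanSpace ℝ (Fin n) → ℝ := (annulus n a b).indicator G with hg
  have hmeas := (isOpen_annulus (n := n) a b).measurableSet
  have hgi : Integrable g := (integrable_indicator_iff hmeas).2 hG
  have hmp := Measure.measurePreserving_homeomorphUnitSphereProd
    (volume : Measure (EuclideanSpace ℝ (Fin n)))
  have hemb := (homeomorphUnitSphereProd (EuclideanSpace ℝ (Fin n))).measurableEmbedding
  set k : (Metric.sphere (0 : EuclideanSpace ℝ (Fin n)) 1) × Ioi (0 : ℝ) → ℝ := fun p =>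
    g (p.2.1 • p.1.1) with hk
  have hcomp : ∀ x : ({0}ᶜ : Set (EuclideanSpace ℝ (Fin n))),
    k (homeomorphUnitSphereProd (EuclideanSpace ℝ (Fin n)) x) = g x := by
    intro x
    have hx : ‖(x : EuclideanSpace ℝ (Fin n))‖ ≠ 0 := norm_ne_zero_iff.2 x.2
    simp [hk, smul_smul, hx]
  have hki : Integrable k
    (ν.prod (.volumeIoiPow (Module.finrank ℝ (EuclideanSpace ℝ (Fin n)) - 1))) := by
    rw [← hmp.integrable_comp_emb hemb]
    have : Integrable g (volume.restrict ({0}ᶜ : Set (EuclideanSpace ℝ (Fin n)))) := hgi.restrict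
    rw [show k ∘ homeomorphUnitSphereProd (EuclideanSpace ℝ (Fin n))
      = g ∘ Subtype.val from funext hcomp]
    exact (integrableOn_iff_comap_subtypeVal (measurableSet_singleton _).compl).1 this
  have h1 : ∫ x in annulus n a b, G x = ∫ θ, ∫ r, k (θ, r)
      ∂(Measure.volumeIoiPow (Module.finrank ℝ (EuclideanSpace ℝ (Fin n)) - 1)) ∂ν := by
    rw [← integral_prod _ hki, ← hmp.integral_comp hemb, ← integral_indicator hmeas]
    simp only [hcomp]
    rw [integral_subtype_comap (measurableSet_singleton _).compl fun x => g x,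
      setIntegral_eq_integral_of_forall_compl_eq_zero]
    intro x hx
    have hx0 : x = 0 := by simpa using hx
    refine indicator_of_notMem (fun hx' => ?_) _
    have := hx'.1
    rw [hx0, norm_zero] at this
    exact absurd this ha.not_gt
  have h2 : ∀ θ : Metric.sphere (0 : EuclideanSpace ℝ (Fin n)) 1, ∫ r, k (θ, r)
      ∂(Measure.volumeIoiPow (Module.finrank ℝ (EuclideanSpace ℝ (Fin n)) - 1))
        = ∫ r in a..b, r ^ (n - 1) * G (r • θ.1) := by
    intro θ
    simp only [Measure.volumeIoiPow, ENNReal.ofReal]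
    rw [integral_withDensity_eq_integral_smul
      (measurable_subtype_coe.pow_const _).real_toNNReal,
      integral_subtype_comap measurableSet_Ioi fun r =>
        Real.toNNReal (r ^ (Module.finrank ℝ (EuclideanSpace ℝ (Fin n)) - 1)) • g (r • θ.1),
      intervalIntegral.integral_of_le hab, integral_Ioc_eq_integral_Ioo]
    have hsub : Ioo a b ⊆ Ioi 0 := fun r hr => ha.trans_lt hr.1
    have hmem : ∀ r : ℝ, 0 < r → (r • θ.1 ∈ annulus n a b ↔ r ∈ Ioo a b) := fun r hr0 => by
      simp [annulus, norm_smul, abs_of_pos hr0]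
    rw [setIntegral_eq_of_subset_of_forall_sdiff_eq_zero measurableSet_Ioi hsub fun r hr => by
      rw [hg, indicator_of_notMem (mt (hmem r hr.1).1 hr.2), smul_zero]]
    refine setIntegral_congr_fun measurableSet_Ioo fun r hr => ?_
    have hr0 : 0 < r := hsub hr
    have hfr : Module.finrank ℝ (EuclideanSpace ℝ (Fin n)) = n := finrank_euclideanSpace_fin
    simp only [hg]
    rw [indicator_of_mem ((hmem r hr0).2 hr), NNReal.smul_def,
      Real.coe_toNNReal _ (pow_nonneg hr0.le _), hfr, smul_eq_mul]
  have h3 : ∀ θ : Metric.sphere (0 : EuclideanSpace ℝ (Fin n)) 1, c ≤ ∫ r, k (θ, r)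
      ∂(Measure.volumeIoiPow (Module.finrank ℝ (EuclideanSpace ℝ (Fin n)) - 1)) := fun θ => by
    rw [h2]; exact h θ.1 (by simp)
  rw [h1]
  have := integral_mono (integrable_const c) hki.integral_prod_left h3
  rwa [integral_const, smul_eq_mul, mul_comm] at this

end

/-! ### Integration along rays -/

section

variable {n : ℕ} {R : ℝ} {V W Y : ℝ → ℝ} {u f : EuclideanSpace ℝ (Fin n) → ℝ}

/-- The difference of the integrands of the two sides of the Hardy-Rellich inequality. -/
noncomputable def rellichDensity (V W : ℝ → ℝ) (u : EuclideanSpace ℝ (Fin n) → ℝ)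
    (x : EuclideanSpace ℝ (Fin n)) : ℝ :=
  V ‖x‖ * Laplacian.laplacian u x ^ 2
    - (W ‖x‖ + ((n : ℝ) - 1) * (V ‖x‖ / ‖x‖ ^ 2 - deriv V ‖x‖ / ‖x‖)) * ‖gradient u x‖ ^ 2

/-- The terms with angular derivatives in the square of `r² Δu = f + casimir u`, where
`f = r² u_rr + (n - 1) r u_r`, up to those that only involve radial derivatives of `u` and of
its first angular derivatives. -/
noncomputable def angularTerm (f u : EuclideanSpace ℝ (Fin n) → ℝ)
    (x : EuclideanSpace ℝ (Fin n)) : ℝ :=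
  2 * (f x * casimir u x) + casimir u x ^ 2
      + ∑ i, ∑ j, angular i j f x * angular i j u x - ((n : ℝ) - 1) * angularNormSq u x

/-- The radial part of `r² Δu`. -/
noncomputable def radialPart (u : EuclideanSpace ℝ (Fin n) → ℝ)
    (x : EuclideanSpace ℝ (Fin n)) : ℝ := euler (euler u) x + ((n : ℝ) - 2) * euler u x

lemma ContDiff.radialPart (hu : ContDiff ℝ ∞ u) : ContDiff ℝ ∞ (radialPart u) :=
  hu.euler.euler.add (contDiff_const.mul hu.euler)

lemma ContDiff.angularTerm (hf : ContDiff ℝ ∞ f) (hu : ContDiff ℝ ∞ u) :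
    ContDiff ℝ ∞ (angularTerm f u) :=
  (((contDiff_const.mul (hf.mul hu.casimir)).add (hu.casimir.pow 2)).add (ContDiff.sum fun i _ =>
    ContDiff.sum fun j _ => (hf.angular i j).mul (hu.angular i j))).sub
      (contDiff_const.mul hu.angularNormSq)

lemma ContDiff.continuous_gradient (hu : ContDiff ℝ ∞ u) : Continuous (gradient u) :=
  (LinearIsometryEquiv.continuous _).comp (hu.continuous_fderiv (by simp))

lemma continuousOn_comp_norm {g : ℝ → ℝ} (hg : ContinuousOn g (Ioo 0 R)) :
    ContinuousOn (fun x : EuclideanSpace ℝ (Fin n) => g ‖x‖) (annulus n 0 R) :=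
  hg.comp continuous_norm.continuousOn fun _ hx => hx

lemma continuousOn_rellichDensity (hV : ContDiffOn ℝ 1 V (Ioo 0 R))
    (hW : ContinuousOn W (Ioo 0 R)) (hu : ContDiff ℝ ∞ u) :
    ContinuousOn (rellichDensity V W u) (annulus n 0 R) := by
  have h0 : ∀ r ∈ Ioo 0 R, r ≠ 0 := fun r hr => hr.1.ne'
  have hV' := hV.continuousOn_deriv_of_isOpen isOpen_Ioo le_rfl
  have h1 : ContinuousOn (fun r => W r + ((n : ℝ) - 1) * (V r / r ^ 2 - deriv V r / r))
      (Ioo 0 R) :=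
    hW.add (continuousOn_const.mul ((hV.continuousOn.div (continuousOn_id.pow 2)
      fun r hr => pow_ne_zero 2 (h0 r hr)).sub (hV'.div continuousOn_id h0)))
  exact ((continuousOn_comp_norm hV.continuousOn).mul
    (hu.laplacian.continuous.pow 2).continuousOn).sub ((continuousOn_comp_norm h1).mul
      (hu.continuous_gradient.norm.pow 2).continuousOn)

lemma ContinuousOn.integrableOn_annulus {G : EuclideanSpace ℝ (Fin n) → ℝ}
    (hG : ContinuousOn G (annulus n 0 R)) {a b : ℝ} (ha : 0 < a) (hb : b < R) :
    IntegrableOn G (annulus n a b) := by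
  have hK : IsCompact {x : EuclideanSpace ℝ (Fin n) | a ≤ ‖x‖ ∧ ‖x‖ ≤ b} := by
    refine (isCompact_closedBall (0 : EuclideanSpace ℝ (Fin n)) b).of_isClosed_subset
      ((isClosed_le continuous_const continuous_norm).inter
        (isClosed_le continuous_norm continuous_const)) fun x hx => by simpa using hx.2
  exact ((hG.mono fun x hx => ⟨ha.trans_le hx.1, hx.2.trans_lt hb⟩).integrableOn_compact
    hK).mono_set fun x hx => ⟨hx.1.le, hx.2.le⟩

lemma norm_smul_unit {θ : EuclideanSpace ℝ (Fin n)} (hθ : ‖θ‖ = 1) {r : ℝ} (hr : 0 < r) :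
    ‖r • θ‖ = r := by rw [norm_smul, hθ, mul_one, Real.norm_of_nonneg hr.le]

lemma ContinuousOn.intervalIntegrable_ray {G : EuclideanSpace ℝ (Fin n) → ℝ}
    (hG : ContinuousOn G (annulus n 0 R)) {a b : ℝ} (ha : 0 < a) (hb : b < R)
    {θ : EuclideanSpace ℝ (Fin n)} (hθ : ‖θ‖ = 1) :
    IntegrableOn (fun r => r ^ (n - 1) * G (r • θ)) (Icc a b) := by
  refine ContinuousOn.integrableOn_Icc ((continuous_pow _).continuousOn.mul
    (hG.comp (by fun_prop) fun r hr => ?_))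
  have h0 := ha.trans_le hr.1
  exact ⟨by rwa [norm_smul_unit hθ h0], by rw [norm_smul_unit hθ h0]; exact hr.2.trans_lt hb⟩

/-- Along a ray, the Euler field is `r d/dr`. -/
lemma hasDerivAt_ray (hu : ContDiff ℝ ∞ u) (θ : EuclideanSpace ℝ (Fin n)) {r : ℝ} (hr : r ≠ 0) :
    HasDerivAt (fun r : ℝ => u (r • θ)) (euler u (r • θ) / r) r := by
  have h1 : HasDerivAt (fun r : ℝ => r • θ) θ r := by
    simpa using (hasDerivAt_id r).smul_const θ
  have h2 := ((hu.differentiable (by simp)).differentiableAt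
    (x := r • θ)).hasFDerivAt.comp_hasDerivAt
    r h1
  refine h2.congr_deriv ?_
  simp only [euler, fieldDeriv, map_smul, smul_eq_mul]
  field_simp

lemma hasDerivAt_ray_div (hu : ContDiff ℝ ∞ u) (θ : EuclideanSpace ℝ (Fin n)) {r : ℝ}
    (hr : r ≠ 0) :
    HasDerivAt (fun r : ℝ => u (r • θ) / r) ((euler u (r • θ) - u (r • θ)) / r ^ 2) r := by
  refine ((hasDerivAt_ray hu θ hr).div (hasDerivAt_id r) hr).congr_deriv ?_
  simp only [id, mul_one, div_mul_cancel₀ _ hr]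

/-- The value at the inner radius of the boundary terms, along the ray through `θ`. -/
noncomputable def rayBoundary (V Y : ℝ → ℝ) (u : EuclideanSpace ℝ (Fin n) → ℝ)
    (θ : EuclideanSpace ℝ (Fin n)) (r : ℝ) : ℝ :=
  (radialFlux n V Y r + ((n : ℝ) - 1) * boundaryWeight n V r) * (euler u (r • θ) / r) ^ 2
    + 1 / 2 * ∑ i, ∑ j, ((2 * radialFlux n V Y r + deriv V r * r ^ (n - 1))
        * (angular i j u (r • θ) / r) ^ 2
      - 2 * boundaryWeight n V r
        * ((angular i j u (r • θ) / r) * (euler (angular i j u) (r • θ) / r)))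

lemma angular_radialPart (hu : ContDiff ℝ ∞ u) (i j : Fin n) (x : EuclideanSpace ℝ (Fin n)) :
    angular i j (radialPart u) x = euler (euler (angular i j u)) x
      + ((n : ℝ) - 2) * euler (angular i j u) x := by
  have h : angular i j (radialPart u) x = _ :=
    fieldDeriv_add hu.euler.euler (contDiff_const.mul hu.euler) x
  rw [h, fieldDeriv_const_mul _ hu.euler]
  have h1 := angular_euler hu i j
  have h2 := angular_euler hu.euler i j
  rw [h1] at h2
  simp only [angular] at h1 h2
  rw [h1, h2]
  rfl

/-- Up to the angular terms, the integrand along a ray is at least the derivative of the boundary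
terms. -/
lemma exists_hasDerivAt_rayBoundary (hn : 1 ≤ n) (hV : ContDiffOn ℝ 2 V (Ioo 0 R))
    (hVpos : ∀ r ∈ Ioo 0 R, 0 < V r) (hY : IsRiccati n R V W Y)
    (hcond : ∀ r ∈ Ioo 0 R,
      0 ≤ W r - 2 * V r / r ^ 2 + 2 * deriv V r / r - deriv (deriv V) r)
    (hu : ContDiff ℝ ∞ u) {θ : EuclideanSpace ℝ (Fin n)} (hθ : ‖θ‖ = 1) {r : ℝ}
    (hr : r ∈ Ioo 0 R) :
    ∃ d : ℝ, HasDerivAt (rayBoundary V Y u θ) d r ∧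
      d ≤ r ^ (n - 1) * (rellichDensity V W u (r • θ)
        - V r / r ^ 4 * angularTerm (radialPart u) u (r • θ)) := by
  have hr0 := hr.1.ne'
  have hV0 := hVpos r hr
  have hA := hY.hasDerivAt_radial hn (hV.of_le one_le_two) hVpos hr
    (hasDerivAt_ray_div hu.euler θ hr0)
  have hB : ∀ i j, _ := fun i j => hY.hasDerivAt_tangential hn hV hVpos hr
    (b := fun r => angular i j u (r • θ) / r) (α := fun r => euler (angular i j u) (r • θ) / r)
    ((hasDerivAt_ray_div (hu.angular i j) θ hr0).congr_deriv (by field_simp))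
    (hasDerivAt_ray_div (hu.angular i j).euler θ hr0)
  refine ⟨_, hA.add ((HasDerivAt.fun_sum fun i _ => HasDerivAt.fun_sum fun j _ =>
    hB i j).const_mul (1 / 2)), ?_⟩
  have hnorm := norm_smul_unit hθ hr.1
  have hlap := norm_sq_mul_laplacian hu (r • θ)
  have hgrad := norm_sq_mul_norm_gradient_sq hu (r • θ)
  rw [hnorm] at hlap hgrad
  have hlap' : Laplacian.laplacian u (r • θ)
      = (radialPart u (r • θ) + casimir u (r • θ)) / r ^ 2 := by
    rw [eq_div_iff (by positivity), mul_comm, hlap]; rfl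
  have hgrad' : ‖gradient u (r • θ)‖ ^ 2
      = (euler u (r • θ) ^ 2 + angularNormSq u (r • θ)) / r ^ 2 := by
    rw [eq_div_iff (by positivity), mul_comm, hgrad]
  set Q := W r + ((n : ℝ) - 1) * (V r / r ^ 2 - deriv V r / r) with hQ
  have hT : r ^ (n - 1) * (rellichDensity V W u (r • θ)
        - V r / r ^ 4 * angularTerm (radialPart u) u (r • θ))
      = r ^ (n - 1) * (V r * (radialPart u (r • θ) / r ^ 2) ^ 2 - Q * (euler u (r • θ) / r) ^ 2)
        + 1 / 2 * ∑ i, ∑ j, r ^ (n - 1) * (-2 * V r / r ^ 4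
            * (angular i j (radialPart u) (r • θ) * angular i j u (r • θ))
          + ((n : ℝ) - 1) * V r / r ^ 4 * angular i j u (r • θ) ^ 2
          - Q / r ^ 2 * angular i j u (r • θ) ^ 2) := by
    rw [rellichDensity, hnorm, ← hQ, hlap', hgrad', angularTerm, angularNormSq]
    simp only [← Finset.mul_sum, Finset.sum_add_distrib, Finset.sum_sub_distrib]
    field_simp
    ring
  rw [hT]
  refine add_le_add ?_ (mul_le_mul_of_nonneg_left (Finset.sum_le_sum fun i _ =>
    Finset.sum_le_sum fun j _ => ?_) (by norm_num))
  · have h1 : (euler (euler u) (r • θ) - euler u (r • θ)) / r ^ 2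
        + ((n : ℝ) - 1) * (euler u (r • θ) / r) / r = radialPart u (r • θ) / r ^ 2 := by
      rw [radialPart]; field_simp; ring
    rw [h1]
    have : 0 ≤ V r * r ^ (n - 1) * ((euler (euler u) (r • θ) - euler u (r • θ)) / r ^ 2
        - Y r * (euler u (r • θ) / r)) ^ 2 :=
      mul_nonneg (mul_nonneg hV0.le (pow_nonneg hr.1.le _)) (sq_nonneg _)
    linarith
  · have h1 : (r * ((euler (euler (angular i j u)) (r • θ) - euler (angular i j u) (r • θ)) / r ^ 2)
        + ((n : ℝ) - 1) * (euler (angular i j u) (r • θ) / r))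
        = angular i j (radialPart u) (r • θ) / r := by
      rw [angular_radialPart hu]; field_simp; ring
    rw [h1]
    have h2 : 0 ≤ V r * r ^ (n - 1) * ((euler (angular i j u) (r • θ) / r
        - angular i j u (r • θ) / r) / r - Y r * (angular i j u (r • θ) / r)) ^ 2 :=
      mul_nonneg (mul_nonneg hV0.le (pow_nonneg hr.1.le _)) (sq_nonneg _)
    have h3 : 0 ≤ r ^ (n - 1) * ((W r - 2 * V r / r ^ 2 + 2 * deriv V r / r - deriv (deriv V) r)
        * (angular i j u (r • θ) / r) ^ 2) :=
      mul_nonneg (pow_nonneg hr.1.le _) (mul_nonneg (hcond r hr) (sq_nonneg _))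
    have h4 : r ^ (n - 1) * (-2 * V r / r ^ 2 * (angular i j (radialPart u) (r • θ) / r
          * (angular i j u (r • θ) / r))
        + ((n : ℝ) - 1) * V r / r ^ 2 * (angular i j u (r • θ) / r) ^ 2
        - Q * (angular i j u (r • θ) / r) ^ 2)
      = r ^ (n - 1) * (-2 * V r / r ^ 4
            * (angular i j (radialPart u) (r • θ) * angular i j u (r • θ))
          + ((n : ℝ) - 1) * V r / r ^ 4 * angular i j u (r • θ) ^ 2
          - Q / r ^ 2 * angular i j u (r • θ) ^ 2) := by
      field_simp
    linarith

lemma fieldDeriv_eq_zero_of_notMem_tsupport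
    {X : EuclideanSpace ℝ (Fin n) → EuclideanSpace ℝ (Fin n)}
    {x : EuclideanSpace ℝ (Fin n)} (hx : x ∉ tsupport u) : fieldDeriv X u x = 0 := by
  rw [fieldDeriv, fderiv_of_notMem_tsupport ℝ hx]; rfl

/-- The inequality on an annulus, with the boundary terms on the inner sphere. -/
lemma le_setIntegral_annulus_rellichDensity (hn : 1 ≤ n) (hV : ContDiffOn ℝ 2 V (Ioo 0 R))
    (hVpos : ∀ r ∈ Ioo 0 R, 0 < V r) (hW : ContinuousOn W (Ioo 0 R)) (hY : IsRiccati n R V W Y)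
    (hcond : ∀ r ∈ Ioo 0 R,
      0 ≤ W r - 2 * V r / r ^ 2 + 2 * deriv V r / r - deriv (deriv V) r)
    (hu : ContDiff ℝ ∞ u) {ε b c : ℝ} (hε : 0 < ε) (hεb : ε ≤ b) (hb : b < R)
    (hsupp : tsupport u ⊆ Metric.ball 0 b)
    (hc : ∀ θ : EuclideanSpace ℝ (Fin n), ‖θ‖ = 1 → rayBoundary V Y u θ ε ≤ c) :
    -c * (volume : Measure (EuclideanSpace ℝ (Fin n))).toSphere.real univ
      ≤ ∫ x in annulus n ε b, rellichDensity V W u x := by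
  have hV1 := hV.of_le one_le_two
  have hTc := continuousOn_rellichDensity hV1 hW hu
  have hS := hu.radialPart.angularTerm hu
  have hwc : ContinuousOn (fun r => V r / r ^ 4) (Ioo 0 R) :=
    hV.continuousOn.div (continuousOn_id.pow 4) fun r hr => pow_ne_zero 4 hr.1.ne'
  have hSc : ContinuousOn (fun x => V ‖x‖ / ‖x‖ ^ 4 * angularTerm (radialPart u) u x)
      (annulus n 0 R) := (continuousOn_comp_norm hwc).mul hS.continuous.continuousOn
  have hsub : Icc ε b ⊆ Ioo 0 R := fun r hr => ⟨hε.trans_le hr.1, hr.2.trans_lt hb⟩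
  have hang : 0 ≤ ∫ x in annulus n ε b, V ‖x‖ / ‖x‖ ^ 4 * angularTerm (radialPart u) u x :=
    setIntegral_annulus_angular_nonneg hn (hwc.mono hsub)
      (fun r hr => div_nonneg (hVpos r (hsub hr)).le (pow_nonneg (hsub hr).1.le 4)) hu hu.radialPart
  have hint := hTc.integrableOn_annulus hε hb
  have hintS := hSc.integrableOn_annulus hε hb
  have hray := mul_toSphere_le_setIntegral_annulus (c := -c) hε.le hεb (hint.sub hintS) ?_
  · have e := integral_sub hint hintS
    have := hray.trans_eq e
    linarith
  · intro θ hθ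
    have hex : ∀ r ∈ Icc ε b, ∃ d, HasDerivAt (rayBoundary V Y u θ) d r ∧
        d ≤ r ^ (n - 1) * (rellichDensity V W u (r • θ)
          - V r / r ^ 4 * angularTerm (radialPart u) u (r • θ)) := fun r hr =>
      exists_hasDerivAt_rayBoundary hn hV hVpos hY hcond hu hθ (hsub hr)
    choose! d hd hle using hex
    have hftc := intervalIntegral.sub_le_integral_of_hasDeriv_right_of_le hεb
      (fun r hr => (hd r hr).continuousAt.continuousWithinAt)
      (fun r hr => (hd r (Ioo_subset_Icc_self hr)).hasDerivWithinAt)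
      ((hTc.sub hSc).intervalIntegrable_ray hε hb hθ) (fun r hr => by
        have h0 := (hsub (Ioo_subset_Icc_self hr)).1
        have := hle r (Ioo_subset_Icc_self hr)
        simp only [Pi.sub_apply, norm_smul_unit hθ h0]
        exact this)
    have hb0 := (hε.trans_le hεb)
    have hout : b • θ ∉ tsupport u := fun h => by
      have := hsupp h
      rw [mem_ball_zero_iff, norm_smul_unit hθ hb0] at this
      exact lt_irrefl _ this
    have hend : rayBoundary V Y u θ b = 0 := by
      have h1 : euler u (b • θ) = 0 := fieldDeriv_eq_zero_of_notMem_tsupport hout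
      have h2 : ∀ i j, angular i j u (b • θ) = 0 := fun i j =>
        fieldDeriv_eq_zero_of_notMem_tsupport hout
      simp [rayBoundary, h1, h2]
    rw [hend] at hftc
    have := hc θ hθ
    linarith

lemma exists_abs_fieldDeriv_div_le (hu : ContDiff ℝ ∞ u)
    (X : EuclideanSpace ℝ (Fin n) →L[ℝ] EuclideanSpace ℝ (Fin n)) :
    ∃ C, 0 ≤ C ∧ ∀ θ : EuclideanSpace ℝ (Fin n), ‖θ‖ = 1 → ∀ r ∈ Ioo 0 R,
      |fieldDeriv X u (r • θ) / r| ≤ C := by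
  obtain ⟨C, hC⟩ :=
    (isCompact_closedBall (0 : EuclideanSpace ℝ (Fin n)) R).exists_bound_of_continuousOn
    (hu.continuous_fderiv (by simp)).continuousOn
  refine ⟨max C 0 * ‖X‖, by positivity, fun θ hθ r hr => ?_⟩
  have hnorm := norm_smul_unit hθ hr.1
  have h1 : fieldDeriv X u (r • θ) / r = fderiv ℝ u (r • θ) (X θ) := by
    have := hr.1.ne'
    simp only [fieldDeriv, map_smul, smul_eq_mul]; field_simp
  rw [h1, ← Real.norm_eq_abs]
  refine ((fderiv ℝ u (r • θ)).le_opNorm _).trans ?_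
  have h2 : ‖X θ‖ ≤ ‖X‖ := by simpa [hθ] using X.le_opNorm θ
  have h3 := hC (r • θ) (by rw [mem_closedBall_zero_iff, hnorm]; exact hr.2.le)
  exact mul_le_mul (h3.trans (le_max_left _ _)) h2 (norm_nonneg _) (by positivity)

/-- The inequality holds, up to an arbitrarily small error, on annuli with suitable arbitrarily
small inner radii and with all outer radii close to `R`. -/
def HasAnnularBound (n : ℕ) (R : ℝ) (V W : ℝ → ℝ) (u : EuclideanSpace ℝ (Fin n) → ℝ) : Prop :=
  ∃ R₀ < R, ∀ η > 0, ∀ ε₀ > 0, ∃ ε, 0 < ε ∧ ε < ε₀ ∧ ∀ b, R₀ < b → ε < b → b < R →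
    -η ≤ ∫ x in annulus n ε b, rellichDensity V W u x

/-- Since `u` is smooth, the first derivatives in the boundary terms are bounded, and the boundary
terms are at most a multiple of `V r^(n-2)`, which tends to zero. -/
lemma hasAnnularBound_of_curvature (hn : 1 ≤ n) (hR : 0 < R) (hV : ContDiffOn ℝ 2 V (Ioo 0 R))
    (hVpos : ∀ r ∈ Ioo 0 R, 0 < V r) (hWnonneg : ∀ r ∈ Ioo 0 R, 0 ≤ W r)
    (hW : ContinuousOn W (Ioo 0 R)) (hY : IsRiccati n R V W Y)
    (hcond : ∀ r ∈ Ioo 0 R,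
      0 ≤ W r - 2 * V r / r ^ 2 + 2 * deriv V r / r - deriv (deriv V) r)
    (hu : IsTestFunction n R u) : HasAnnularBound n R V W u := by
  obtain ⟨hu, hcomp, hsupp⟩ := hu
  obtain ⟨R₀, hR₀, hsupp₀⟩ := exists_pos_lt_subset_ball hR (isClosed_tsupport u) hsupp
  refine ⟨R₀, hR₀.2, fun η hη ε₀ hε₀ => ?_⟩
  suffices h : ∃ ε, 0 < ε ∧ ε < ε₀ ∧ ε < R ∧ ∃ c,
      c * (volume : Measure (EuclideanSpace ℝ (Fin n))).toSphere.real univ ≤ η ∧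
      ∀ θ : EuclideanSpace ℝ (Fin n), ‖θ‖ = 1 → rayBoundary V Y u θ ε ≤ c by
    obtain ⟨ε, hε, hεε₀, _, c, hcη, hc⟩ := h
    refine ⟨ε, hε, hεε₀, fun b hb hεb hbR => ?_⟩
    have := le_setIntegral_annulus_rellichDensity hn hV hVpos hW hY hcond hu hε hεb.le hbR
      (hsupp₀.trans (Metric.ball_subset_ball hb.le)) hc
    linarith
  obtain ⟨Ca, hCa0, hCa⟩ := exists_abs_fieldDeriv_div_le (R := R) hu (ContinuousLinearMap.id ℝ _)
  choose Cb hCb0 hCb using fun i j : Fin n =>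
    exists_abs_fieldDeriv_div_le (R := R) hu (rotField i j)
  choose Cα hCα0 hCα using fun i j : Fin n =>
    exists_abs_fieldDeriv_div_le (R := R) (hu.angular i j) (ContinuousLinearMap.id ℝ _)
  have hn' : (1 : ℝ) ≤ n := by exact_mod_cast hn
  set M : ℝ := ((n : ℝ) - 1) * Ca ^ 2
    + 1 / 2 * ∑ i, ∑ j, ((n + 2) * Cb i j ^ 2 + 2 * (Cb i j * Cα i j)) with hM
  have hbound : ∀ θ : EuclideanSpace ℝ (Fin n), ‖θ‖ = 1 → ∀ r ∈ Ioo 0 R,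
      rayBoundary V Y u θ r ≤ boundaryWeight n V r * M := by
    intro θ hθ r hr
    have hq := hY.radialFlux_nonpos hn hV hVpos hWnonneg hcond r hr
    have hP := boundaryWeight_pos (n := n) hVpos hr
    have ht := hY.tangential_boundary_le hn hV hVpos hWnonneg hcond hr
    have hsum : boundaryWeight n V r * (1 / 2 * ∑ i, ∑ j,
          ((n + 2) * Cb i j ^ 2 + 2 * (Cb i j * Cα i j)))
        = 1 / 2 * ∑ i, ∑ j, boundaryWeight n V r
          * ((n + 2) * Cb i j ^ 2 + 2 * (Cb i j * Cα i j)) := by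
      simp only [← Finset.mul_sum]
      ring
    rw [rayBoundary, hM, mul_add, hsum]
    refine add_le_add ?_ (mul_le_mul_of_nonneg_left (Finset.sum_le_sum fun i _ =>
      Finset.sum_le_sum fun j _ => ?_) (by norm_num : (0 : ℝ) ≤ 1 / 2))
    · have h1 : (euler u (r • θ) / r) ^ 2 ≤ Ca ^ 2 := by
        rw [← sq_abs]
        exact pow_le_pow_left₀ (abs_nonneg _) (hCa θ hθ r hr) 2
      calc _ ≤ (((n : ℝ) - 1) * boundaryWeight n V r) * (euler u (r • θ) / r) ^ 2 :=
            mul_le_mul_of_nonneg_right (by linarith) (sq_nonneg _)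
        _ ≤ (((n : ℝ) - 1) * boundaryWeight n V r) * Ca ^ 2 :=
            mul_le_mul_of_nonneg_left h1 (mul_nonneg (by linarith) hP.le)
        _ = _ := by ring
    · have h1 : (angular i j u (r • θ) / r) ^ 2 ≤ Cb i j ^ 2 := by
        rw [← sq_abs]
        exact pow_le_pow_left₀ (abs_nonneg _) (hCb i j θ hθ r hr) 2
      have h2 : -((angular i j u (r • θ) / r) * (euler (angular i j u) (r • θ) / r))
          ≤ Cb i j * Cα i j := by
        refine (neg_le_abs _).trans ?_
        rw [abs_mul]
        exact mul_le_mul (hCb i j θ hθ r hr) (hCα i j θ hθ r hr) (abs_nonneg _) (hCb0 i j)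
      have h3 : (2 * radialFlux n V Y r + deriv V r * r ^ (n - 1))
          * (angular i j u (r • θ) / r) ^ 2 ≤ (n + 2) * boundaryWeight n V r * Cb i j ^ 2 :=
        (mul_le_mul_of_nonneg_right ht (sq_nonneg _)).trans
          (mul_le_mul_of_nonneg_left h1 (by positivity))
      have h4 := mul_le_mul_of_nonneg_left h2 (by positivity : 0 ≤ 2 * boundaryWeight n V r)
      linarith
  obtain rfl | hn2 : n = 1 ∨ 2 ≤ n := by omega
  · -- In dimension one there is neither a tangential gradient nor a boundary weight.
    have hmin : 0 < min ε₀ R := lt_min hε₀ hR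
    refine ⟨min ε₀ R / 2, by positivity, ?_, ?_, 0, by simpa using hη.le, fun θ hθ => ?_⟩
    · linarith [min_le_left ε₀ R]
    · linarith [min_le_right ε₀ R]
    · have hr : min ε₀ R / 2 ∈ Ioo 0 R := ⟨by positivity, by linarith [min_le_right ε₀ R]⟩
      have hq := hY.radialFlux_nonpos hn hV hVpos hWnonneg hcond _ hr
      have h0 : ∀ i j : Fin 1, ∀ x, angular i j u x = 0 := by
        intro i j x
        rw [Subsingleton.elim i j]
        simp [angular, fieldDeriv, rotField_apply]
      simp only [rayBoundary, h0, Nat.cast_one, sub_self, zero_mul, zero_div, add_zero, mul_zero,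
        zero_pow two_ne_zero, Finset.sum_const_zero]
      exact mul_nonpos_of_nonpos_of_nonneg hq (sq_nonneg _)
  · have hlim := hY.tendsto_boundaryWeight hn2 hR hV hVpos hcond
    have hlim' : Filter.Tendsto (fun r => boundaryWeight n V r * M
        * (volume : Measure (EuclideanSpace ℝ (Fin n))).toSphere.real univ)
        (nhdsWithin 0 (Ioi 0)) (nhds 0) := by
      simpa using (hlim.mul_const M).mul_const
        ((volume : Measure (EuclideanSpace ℝ (Fin n))).toSphere.real univ)
    have hev := (hlim'.eventually (ge_mem_nhds hη)).and
      (Ioo_mem_nhdsGT (lt_min hε₀ hR) : Ioo 0 (min ε₀ R) ∈ nhdsWithin (0 : ℝ) (Ioi 0))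
    obtain ⟨ε, h1, h2⟩ := hev.exists
    have hεR := h2.2.trans_le (min_le_right _ _)
    exact ⟨ε, h2.1, h2.2.trans_le (min_le_left _ _), hεR, _, h1,
      fun θ hθ => hbound θ hθ ε ⟨h2.1, hεR⟩⟩

end

/-! ### Radial functions -/

section

variable {n : ℕ} {R : ℝ} {V W Y : ℝ → ℝ} {u : EuclideanSpace ℝ (Fin n) → ℝ}

lemma IsRadial.angular_eq_zero (hu : ContDiff ℝ ∞ u) (hrad : IsRadial n u) (i j : Fin n)
    (x : EuclideanSpace ℝ (Fin n)) : angular i j u x = 0 := by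
  have h1 := hasDerivAt_comp_rotFlow (rotField_cube i j) hu 0 x
  have h2 : (fun t => u (rotFlow (rotField i j) t x)) = fun _ => u x := by
    funext t
    exact hrad _ _ (norm_rotFlow (rotField_cube i j) (inner_rotField_self i j) t x)
  rw [h2, rotFlow_zero] at h1
  exact h1.unique (hasDerivAt_const 0 (u x))

lemma IsRadial.casimir_eq_zero (hu : ContDiff ℝ ∞ u) (hrad : IsRadial n u)
    (x : EuclideanSpace ℝ (Fin n)) : casimir u x = 0 := by
  have h : ∀ i j, angular i j u = fun _ => 0 := fun i j =>
    funext fun x => hrad.angular_eq_zero hu i j x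
  have h0 : ∀ i j, angular i j (fun _ : EuclideanSpace ℝ (Fin n) => (0 : ℝ)) x = 0 := by
    intro i j; simp [angular, fieldDeriv]
  simp [casimir, h, h0]

lemma IsRadial.angularNormSq_eq_zero (hu : ContDiff ℝ ∞ u) (hrad : IsRadial n u)
    (x : EuclideanSpace ℝ (Fin n)) : angularNormSq u x = 0 := by
  simp [angularNormSq, hrad.angular_eq_zero hu]

lemma IsRadial.euler (hu : ContDiff ℝ ∞ u) (hrad : IsRadial n u) : IsRadial n (euler u) := by
  intro x y hxy
  rcases eq_or_ne x 0 with rfl | hx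
  · rw [norm_zero, eq_comm, norm_eq_zero] at hxy
    rw [hxy]
  · have hr : ‖x‖ ≠ 0 := norm_ne_zero_iff.2 hx
    set θ := ‖x‖⁻¹ • x with hθ
    set ζ := ‖x‖⁻¹ • y with hζ
    have hxθ : x = ‖x‖ • θ := by rw [hθ, smul_smul, mul_inv_cancel₀ hr, one_smul]
    have hyζ : y = ‖x‖ • ζ := by rw [hζ, smul_smul, mul_inv_cancel₀ hr, one_smul]
    have hnorm : ‖θ‖ = ‖ζ‖ := by rw [hθ, hζ, norm_smul, norm_smul, hxy]
    have h1 := hasDerivAt_ray hu θ hr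
    have h2 := hasDerivAt_ray hu ζ hr
    have h3 : (fun r : ℝ => u (r • θ)) = fun r => u (r • ζ) := by
      funext r
      exact hrad _ _ (by rw [norm_smul r θ, norm_smul r ζ, hnorm])
    rw [h3] at h1
    have h4 := h1.unique h2
    rw [← hxθ, ← hyζ] at h4
    exact (div_left_inj' hr).1 h4

lemma IsRadial.norm_sq_mul_laplacian (hu : ContDiff ℝ ∞ u) (hrad : IsRadial n u)
    (x : EuclideanSpace ℝ (Fin n)) :
    ‖x‖ ^ 2 * Laplacian.laplacian u x = radialPart u x := by
  rw [_root_.norm_sq_mul_laplacian hu, hrad.casimir_eq_zero hu, add_zero]; rfl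

lemma IsRadial.radialPart (hu : ContDiff ℝ ∞ u) (hrad : IsRadial n u) :
    IsRadial n (radialPart u) := by
  intro x y hxy
  rw [_root_.radialPart, _root_.radialPart, hrad.euler hu x y hxy,
    (hrad.euler hu).euler hu.euler x y hxy]

lemma IsRadial.fderiv_zero (hu : ContDiff ℝ ∞ u) (hrad : IsRadial n u)
    (θ : EuclideanSpace ℝ (Fin n)) : fderiv ℝ u 0 θ = 0 := by
  have h1 : ∀ v : EuclideanSpace ℝ (Fin n),
      HasDerivAt (fun r : ℝ => u (r • v)) (fderiv ℝ u 0 v) 0 := by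
    intro v
    have h : HasDerivAt (fun r : ℝ => r • v) v 0 := by
      simpa using (hasDerivAt_id (0 : ℝ)).smul_const v
    have hd := ((hu.differentiable (by simp)).differentiableAt (x := (0 : ℝ) • v)).hasFDerivAt
    have h' := hd.comp_hasDerivAt (0 : ℝ) h
    rw [zero_smul] at h'
    exact h'
  have h2 := h1 (-θ)
  have h3 : (fun r : ℝ => u (r • -θ)) = fun r => u (r • θ) := by
    funext r
    exact hrad _ _ (by rw [norm_smul, norm_smul, norm_neg])
  rw [h3] at h2
  have := h2.unique (h1 θ)
  rw [map_neg] at this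
  linarith

/-- The inequality on an annulus for radial functions, with the boundary term on the inner sphere.
No second derivative of `V` is involved. -/
lemma IsRadial.le_setIntegral_annulus_rellichDensity (hn : 1 ≤ n)
    (hV : ContDiffOn ℝ 1 V (Ioo 0 R))
    (hVpos : ∀ r ∈ Ioo 0 R, 0 < V r) (hW : ContinuousOn W (Ioo 0 R)) (hY : IsRiccati n R V W Y)
    (hu : ContDiff ℝ ∞ u) (hrad : IsRadial n u) {ε b c : ℝ} (hε : 0 < ε) (hεb : ε ≤ b)
    (hb : b < R) (hsupp : tsupport u ⊆ Metric.ball 0 b)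
    (hc : ∀ θ : EuclideanSpace ℝ (Fin n), ‖θ‖ = 1 → (radialFlux n V Y ε
      + ((n : ℝ) - 1) * boundaryWeight n V ε) * (_root_.euler u (ε • θ) / ε) ^ 2 ≤ c) :
    -c * (volume : Measure (EuclideanSpace ℝ (Fin n))).toSphere.real univ
      ≤ ∫ x in annulus n ε b, rellichDensity V W u x := by
  have hTc := continuousOn_rellichDensity hV hW hu
  have hsub : Icc ε b ⊆ Ioo 0 R := fun r hr => ⟨hε.trans_le hr.1, hr.2.trans_lt hb⟩
  refine mul_toSphere_le_setIntegral_annulus hε.le hεb (hTc.integrableOn_annulus hε hb) ?_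
  intro θ hθ
  have hftc := intervalIntegral.sub_le_integral_of_hasDeriv_right_of_le hεb
    (fun r hr => (hY.hasDerivAt_radial hn hV hVpos (hsub hr) (hasDerivAt_ray_div hu.euler θ
      (hsub hr).1.ne')).continuousAt.continuousWithinAt)
    (fun r hr => (hY.hasDerivAt_radial hn hV hVpos (hsub (Ioo_subset_Icc_self hr))
      (hasDerivAt_ray_div hu.euler θ (hsub (Ioo_subset_Icc_self hr)).1.ne')).hasDerivWithinAt)
    (hTc.intervalIntegrable_ray hε hb hθ) (fun r hr => ?_)
  · have hb0 := (hε.trans_le hεb)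
    have hout : b • θ ∉ tsupport u := fun h => by
      have := hsupp h
      rw [mem_ball_zero_iff, norm_smul_unit hθ hb0] at this
      exact lt_irrefl _ this
    have h1 : _root_.euler u (b • θ) = 0 := fieldDeriv_eq_zero_of_notMem_tsupport hout
    rw [h1] at hftc
    have := hc θ hθ
    norm_num at hftc
    linarith
  · have hr' := hsub (Ioo_subset_Icc_self hr)
    have hr0 := hr'.1.ne'
    have hnorm := norm_smul_unit hθ hr'.1
    have hlap := hrad.norm_sq_mul_laplacian hu (r • θ)
    have hgrad := norm_sq_mul_norm_gradient_sq hu (r • θ)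
    rw [hnorm] at hlap hgrad
    rw [hrad.angularNormSq_eq_zero hu, add_zero] at hgrad
    have hlap' : Laplacian.laplacian u (r • θ) = _root_.radialPart u (r • θ) / r ^ 2 := by
      rw [eq_div_iff (by positivity), mul_comm, hlap]
    have hgrad' : ‖gradient u (r • θ)‖ ^ 2 = (_root_.euler u (r • θ) / r) ^ 2 := by
      rw [div_pow, eq_div_iff (by positivity), mul_comm, hgrad]
    have h1 : (_root_.euler (_root_.euler u) (r • θ) - _root_.euler u (r • θ)) / r ^ 2
        + ((n : ℝ) - 1) * (_root_.euler u (r • θ) / r) / r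
        = _root_.radialPart u (r • θ) / r ^ 2 := by
      rw [_root_.radialPart]; field_simp; ring
    rw [rellichDensity, hnorm, hlap', hgrad', h1]
    have hV0 := hVpos r hr'
    have : 0 ≤ V r * r ^ (n - 1) * ((_root_.euler (_root_.euler u) (r • θ)
        - _root_.euler u (r • θ)) / r ^ 2 - Y r * (_root_.euler u (r • θ) / r)) ^ 2 :=
      mul_nonneg (mul_nonneg hV0.le (pow_nonneg hr'.1.le _)) (sq_nonneg _)
    linarith

/-- A nonnegative function whose integrals away from zero are bounded has small integrals near
zero. -/
lemma exists_forall_integral_le {e : ℝ → ℝ} (he : ContinuousOn e (Ioo 0 R))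
    (he0 : ∀ r ∈ Ioo 0 R, 0 ≤ e r) {r₀ K : ℝ} (hr₀ : r₀ ∈ Ioo 0 R)
    (hK : ∀ s ∈ Ioc 0 r₀, ∫ t in s..r₀, e t ≤ K) {η : ℝ} (hη : 0 < η) :
    ∃ r₁ ∈ Ioc 0 r₀, ∀ r ∈ Ioc 0 r₁, ∀ s ∈ Ioc 0 r, ∫ t in s..r, e t ≤ η := by
  set S := (fun s => ∫ t in s..r₀, e t) '' Ioc 0 r₀ with hS
  have hne : S.Nonempty := ⟨_, r₀, ⟨hr₀.1, le_rfl⟩, rfl⟩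
  have hbdd : BddAbove S := ⟨K, by rintro _ ⟨s, hs, rfl⟩; exact hK s hs⟩
  obtain ⟨_, ⟨r₁, hr₁, rfl⟩, hlt⟩ := exists_lt_of_lt_csSup hne (sub_lt_self (sSup S) hη)
  have hint : ∀ s ∈ Ioc 0 r₀, ∀ r ∈ Ioc 0 r₀, IntervalIntegrable e volume s r := by
    intro s hs r hr
    refine (he.mono fun t ht => ?_).intervalIntegrable
    rw [mem_uIcc] at ht
    rcases ht with ht | ht
    · exact ⟨hs.1.trans_le ht.1, (ht.2.trans hr.2).trans_lt hr₀.2⟩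
    · exact ⟨hr.1.trans_le ht.1, (ht.2.trans hs.2).trans_lt hr₀.2⟩
  refine ⟨r₁, hr₁, fun r hr s hs => ?_⟩
  have hr' : r ∈ Ioc 0 r₀ := ⟨hr.1, hr.2.trans hr₁.2⟩
  have hs' : s ∈ Ioc 0 r₀ := ⟨hs.1, hs.2.trans hr'.2⟩
  have h1 := intervalIntegral.integral_add_adjacent_intervals (hint s hs' r hr') (hint r hr' r₁ hr₁)
  have h2 := intervalIntegral.integral_add_adjacent_intervals (hint s hs' r₁ hr₁)
    (hint r₁ hr₁ r₀ ⟨hr₀.1, le_rfl⟩)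
  have h3 : 0 ≤ ∫ t in r..r₁, e t := intervalIntegral.integral_nonneg hr.2 fun t ht =>
    he0 t ⟨hr.1.trans_le ht.1, (ht.2.trans hr₁.2).trans_lt hr₀.2⟩
  have h4 : ∫ t in s..r₀, e t ≤ sSup S := le_csSup hbdd ⟨s, hs', rfl⟩
  simp only at hlt
  linarith

/-- The boundary term with the flux is controlled by the energy of `a` below the radius `r`. The
Bessel pair is applied to `ψ - ψ(s)`, where `ψ = r^(n-1) a`, which vanishes at the inner radius
`s`; then `s` tends to zero. -/
lemma IsRiccati.radialFlux_mul_sq_le (hn : 1 ≤ n) (hV : ContDiffOn ℝ 1 V (Ioo 0 R))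
    (hVpos : ∀ r ∈ Ioo 0 R, 0 < V r) (hWnonneg : ∀ r ∈ Ioo 0 R, 0 ≤ W r)
    (hY : IsRiccati n R V W Y) {a D : ℝ → ℝ} (hD : ContinuousOn D (Ioo 0 R))
    (ha : ∀ r ∈ Ioo 0 R, HasDerivAt (fun r => r ^ (n - 1) * a r) (r ^ (n - 1) * D r) r)
    (hlim : Filter.Tendsto (fun r => r ^ (n - 1) * a r) (nhdsWithin 0 (Ioi 0)) (nhds 0))
    {r η : ℝ} (hr : r ∈ Ioo 0 R)
    (hη : ∀ s ∈ Ioc 0 r, ∫ t in s..r, V t * t ^ (n - 1) * D t ^ 2 ≤ η) :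
    radialFlux n V Y r * a r ^ 2 ≤ η := by
  set ψ : ℝ → ℝ := fun r => r ^ (n - 1) * a r with hψ
  have hwpos : 0 < r ^ (n - 1) := pow_pos hr.1 _
  have key : ∀ s ∈ Ioo 0 r, radialFlux n V Y r * (ψ r - ψ s) ^ 2 ≤ (r ^ (n - 1)) ^ 2 * η := by
    intro s hs
    have hsub : Icc s r ⊆ Ioo 0 R := fun t ht => ⟨hs.1.trans_le ht.1, ht.2.trans_lt hr.2⟩
    have hd : ∀ t ∈ Icc s r, HasDerivAt (fun t => radialFlux n V Y t * (ψ t - ψ s) ^ 2) _ t :=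
      fun t ht => (hY.hasDerivAt_radialFlux hn hV hVpos (hsub ht)).mul
        (((ha t (hsub ht)).sub_const (ψ s)).pow 2)
    have hftc := intervalIntegral.sub_le_integral_of_hasDeriv_right_of_le hs.2.le
      (fun t ht => (hd t ht).continuousAt.continuousWithinAt)
      (fun t ht => (hd t (Ioo_subset_Icc_self ht)).hasDerivWithinAt)
      (φ := fun t => (r ^ (n - 1)) ^ 2 * (V t * t ^ (n - 1) * D t ^ 2))
      ((continuousOn_const.mul (((hV.continuousOn.mul (continuous_pow _).continuousOn).mul
        (hD.pow 2)).mono hsub)).integrableOn_Icc) ?_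
    · rw [intervalIntegral.integral_const_mul] at hftc
      have := mul_le_mul_of_nonneg_left (hη s ⟨hs.1, hs.2.le⟩) (sq_nonneg (r ^ (n - 1)))
      simp only [sub_self, zero_pow two_ne_zero, mul_zero, sub_zero] at hftc
      exact hftc.trans this
    · intro t ht
      have ht' := hsub (Ioo_subset_Icc_self ht)
      have hV0 := hVpos t ht'
      have hW0 := hWnonneg t ht'
      have hw0 : 0 < t ^ (n - 1) := pow_pos ht'.1 _
      have hw : (t ^ (n - 1)) ^ 2 ≤ (r ^ (n - 1)) ^ 2 :=
        pow_le_pow_left₀ hw0.le (pow_le_pow_left₀ ht'.1.le ht.2.le _) 2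
      have h1 : (t ^ (n - 1)) ^ 2 * (V t * t ^ (n - 1) * D t ^ 2)
          ≤ (r ^ (n - 1)) ^ 2 * (V t * t ^ (n - 1) * D t ^ 2) :=
        mul_le_mul_of_nonneg_right hw (by positivity)
      refine le_trans ?_ h1
      have h2 : 0 ≤ W t * t ^ (n - 1) * (ψ t - ψ s) ^ 2 := by positivity
      have h3 : 0 ≤ V t * t ^ (n - 1) * (t ^ (n - 1) * D t - Y t * (ψ t - ψ s)) ^ 2 := by positivity
      simp only [radialFlux, Nat.cast_ofNat, Nat.add_one_sub_one, pow_one]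
      nlinarith
  have hlim2 : Filter.Tendsto (fun s => radialFlux n V Y r * (ψ r - ψ s) ^ 2)
      (nhdsWithin 0 (Ioi 0)) (nhds (radialFlux n V Y r * (ψ r - 0) ^ 2)) :=
    ((tendsto_const_nhds.sub hlim).pow 2).const_mul _
  have hle := le_of_tendsto hlim2 (Filter.mem_of_superset (Ioo_mem_nhdsGT hr.1) key)
  have h5 : radialFlux n V Y r * (ψ r - 0) ^ 2
      = (r ^ (n - 1)) ^ 2 * (radialFlux n V Y r * a r ^ 2) := by
    simp only [hψ]; ring
  rw [h5] at hle
  exact le_of_mul_le_mul_left hle (by positivity)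

/-- The other boundary term is small along a sequence of radii: otherwise the finite energy of
`ψ = r^(n-1) a` would bound `|ψ|` below by a multiple of `r^(1/2)`, whereas `ψ = O(r^(n-1))`. -/
lemma exists_boundaryWeight_mul_sq_le (hn : 2 ≤ n) (hV : ContDiffOn ℝ 1 V (Ioo 0 R))
    (hVpos : ∀ r ∈ Ioo 0 R, 0 < V r) {a D : ℝ → ℝ} (hD : ContinuousOn D (Ioo 0 R))
    (ha : ∀ r ∈ Ioo 0 R, HasDerivAt (fun r => r ^ (n - 1) * a r) (r ^ (n - 1) * D r) r)
    {C : ℝ} (hC : ∀ r ∈ Ioo 0 R, |a r| ≤ C) {r₀ K δ : ℝ} (hr₀ : r₀ ∈ Ioo 0 R)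
    (hK : ∀ s ∈ Ioc 0 r₀, ∫ t in s..r₀, V t * t ^ (n - 1) * D t ^ 2 ≤ K) (hδ : 0 < δ) :
    ∃ r ∈ Ioc 0 r₀, boundaryWeight n V r * a r ^ 2 ≤ δ := by
  by_contra! hcon
  set ψ : ℝ → ℝ := fun r => r ^ (n - 1) * a r with hψ
  have hsub : ∀ {s}, 0 < s → Icc s r₀ ⊆ Ioo 0 R :=
    fun hs t ht => ⟨hs.trans_le ht.1, ht.2.trans_lt hr₀.2⟩
  have ha0 : ∀ r ∈ Ioc 0 r₀, a r ≠ 0 := by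
    intro r hr h0
    have := hcon r hr
    rw [h0] at this
    norm_num at this
    linarith
  have hψ0 : ∀ r ∈ Ioc 0 r₀, ψ r ≠ 0 := fun r hr =>
    mul_ne_zero (pow_ne_zero _ hr.1.ne') (ha0 r hr)
  set f : ℝ → ℝ := fun r => Real.log (ψ r ^ 2) - Real.log r with hf
  have hlow : ∀ s ∈ Ioc 0 r₀, f r₀ - K / δ ≤ f s := by
    intro s hs
    have hd : ∀ t ∈ Icc s r₀, HasDerivAt f _ t := fun t ht =>
      (((ha t (hsub hs.1 ht)).pow 2).log (pow_ne_zero 2 (hψ0 t ⟨hs.1.trans_le ht.1, ht.2⟩))).sub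
        (Real.hasDerivAt_log (hs.1.trans_le ht.1).ne')
    have hftc := intervalIntegral.sub_le_integral_of_hasDeriv_right_of_le hs.2
      (fun t ht => (hd t ht).continuousAt.continuousWithinAt)
      (fun t ht => (hd t (Ioo_subset_Icc_self ht)).hasDerivWithinAt)
      (φ := fun t => δ⁻¹ * (V t * t ^ (n - 1) * D t ^ 2))
      ((continuousOn_const.mul (((hV.continuousOn.mul (continuous_pow _).continuousOn).mul
        (hD.pow 2)).mono (hsub hs.1))).integrableOn_Icc) ?_
    · rw [intervalIntegral.integral_const_mul] at hftc
      have := mul_le_mul_of_nonneg_left (hK s hs) (inv_nonneg.2 hδ.le)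
      rw [div_eq_inv_mul]
      linarith
    · intro t ht
      have ht' : t ∈ Ioc 0 r₀ := ⟨hs.1.trans ht.1, ht.2.le⟩
      have h0 := ha0 t ht'
      have ht0 : 0 < t := ht'.1
      have hV0 := hVpos t (hsub hs.1 (Ioo_subset_Icc_self ht))
      have hw0 : 0 < t ^ (n - 1) := pow_pos ht0 _
      have h1 := hcon t ht'
      have h2 : t * (D t / a t) ^ 2 ≤ δ⁻¹ * (V t * t ^ (n - 1) * D t ^ 2) := by
        rw [boundaryWeight] at h1
        have ha2 : 0 < a t ^ 2 := by positivity
        rw [inv_mul_eq_div, le_div_iff₀ hδ, div_pow]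
        have h3 : δ * t ≤ V t * t ^ (n - 1) * a t ^ 2 := by
          have h4 : V t * t ^ (n - 1) / t * a t ^ 2 * t = V t * t ^ (n - 1) * a t ^ 2 := by
            field_simp
          rw [← h4]
          exact mul_le_mul_of_nonneg_right h1.le ht0.le
        calc t * (D t ^ 2 / a t ^ 2) * δ = (δ * t) * (D t ^ 2 / a t ^ 2) := by ring
          _ ≤ (V t * t ^ (n - 1) * a t ^ 2) * (D t ^ 2 / a t ^ 2) :=
              mul_le_mul_of_nonneg_right h3 (by positivity)
          _ = _ := by field_simp
      refine le_trans ?_ h2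
      simp only [Pi.pow_apply, hψ, Nat.cast_ofNat, Nat.add_one_sub_one, pow_one]
      have h5 : 2 * (t ^ (n - 1) * a t) * (t ^ (n - 1) * D t) / (t ^ (n - 1) * a t) ^ 2
          = 2 * (D t / a t) := by field_simp
      rw [h5]
      have h6 : 0 ≤ t * (D t / a t - t⁻¹) ^ 2 := by positivity
      have h7 : t * (D t / a t - t⁻¹) ^ 2 = t * (D t / a t) ^ 2 - 2 * (D t / a t) + t⁻¹ := by
        field_simp
        ring
      linarith
  -- The lower bound contradicts `ψ² / r ≤ C² r`.
  have hup : ∀ s ∈ Ioc 0 (min r₀ 1), Real.exp (f r₀ - K / δ) ≤ C ^ 2 * s := by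
    intro s hs
    have hs' : s ∈ Ioc 0 r₀ := ⟨hs.1, hs.2.trans (min_le_left _ _)⟩
    have hs1 : s ≤ 1 := hs.2.trans (min_le_right _ _)
    have hψpos : 0 < ψ s ^ 2 := by have := hψ0 s hs'; positivity
    have h1 := hlow s hs'
    rw [hf] at h1
    simp only at h1
    rw [← Real.log_div hψpos.ne' hs.1.ne', Real.le_log_iff_exp_le (div_pos hψpos hs.1)] at h1
    refine h1.trans ?_
    rw [div_le_iff₀ hs.1]
    have h2 : s ^ (n - 1) ≤ s := by
      simpa using pow_le_pow_of_le_one hs.1.le hs1 (by omega : 1 ≤ n - 1)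
    have h3 : a s ^ 2 ≤ C ^ 2 := by
      rw [← sq_abs]
      exact pow_le_pow_left₀ (abs_nonneg _) (hC s ⟨hs.1, hs'.2.trans_lt hr₀.2⟩) 2
    calc ψ s ^ 2 = (s ^ (n - 1)) ^ 2 * a s ^ 2 := by simp only [hψ]; ring
      _ ≤ s ^ 2 * C ^ 2 := mul_le_mul (pow_le_pow_left₀ (pow_nonneg hs.1.le _) h2 2) h3
          (sq_nonneg _) (sq_nonneg _)
      _ = C ^ 2 * s * s := by ring
  have hlim : Filter.Tendsto (fun s : ℝ => C ^ 2 * s) (nhdsWithin 0 (Ioi 0)) (nhds 0) := by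
    have : Filter.Tendsto (fun s : ℝ => C ^ 2 * s) (nhds 0) (nhds (C ^ 2 * 0)) :=
      (continuous_const.mul continuous_id).tendsto 0
    rw [mul_zero] at this
    exact this.mono_left nhdsWithin_le_nhds
  have := ge_of_tendsto hlim (Filter.mem_of_superset
    (Ioc_mem_nhdsGT (lt_min hr₀.1 one_pos)) hup)
  exact absurd this (Real.exp_pos _).not_ge

/-- If `∫ V |Δu|²` is finite, the boundary terms of a radial function are bounded by the tails of
this integral, at suitable inner radii. -/
lemma IsRadial.hasAnnularBound (hn : 1 ≤ n) (hR : 0 < R) (hV : ContDiffOn ℝ 1 V (Ioo 0 R))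
    (hVpos : ∀ r ∈ Ioo 0 R, 0 < V r) (hWnonneg : ∀ r ∈ Ioo 0 R, 0 ≤ W r)
    (hW : ContinuousOn W (Ioo 0 R)) (hY : IsRiccati n R V W Y)
    (hu : IsTestFunction n R u) (hrad : IsRadial n u) {L : ℝ}
    (hL : ∀ ε b, 0 < ε → ε < b → b < R →
      ∫ x in annulus n ε b, V ‖x‖ * Laplacian.laplacian u x ^ 2 ≤ L) :
    HasAnnularBound n R V W u := by
  obtain ⟨hu, hcomp, hsupp⟩ := hu
  obtain ⟨R₀, hR₀, hsupp₀⟩ := exists_pos_lt_subset_ball hR (isClosed_tsupport u) hsupp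
  have : Nonempty (Fin n) := ⟨⟨0, hn⟩⟩
  have : Nontrivial (EuclideanSpace ℝ (Fin n)) := by infer_instance
  set σ := (volume : Measure (EuclideanSpace ℝ (Fin n))).toSphere.real univ with hσ
  have hσpos : 0 < σ := by
    rw [hσ, Measure.toSphere_real_apply_univ, finrank_euclideanSpace_fin]
    have h1 : (0 : ℝ) < n := by exact_mod_cast hn
    have h2 : 0 < (volume : Measure (EuclideanSpace ℝ (Fin n))).real (Metric.ball 0 1) :=
      ENNReal.toReal_pos (Metric.measure_ball_pos _ _ one_pos).ne' measure_ball_lt_top.ne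
    positivity
  obtain ⟨θ, hθ⟩ : ∃ θ : EuclideanSpace ℝ (Fin n), ‖θ‖ = 1 :=
    ⟨EuclideanSpace.single ⟨0, hn⟩ 1, by simp⟩
  set a : ℝ → ℝ := fun r => _root_.euler u (r • θ) / r with ha_def
  set D : ℝ → ℝ := fun r => _root_.radialPart u (r • θ) / r ^ 2 with hD_def
  have hD : ContinuousOn D (Ioo 0 R) :=
    ((hu.radialPart.continuous.comp (by fun_prop : Continuous fun r : ℝ => r • θ)).continuousOn).div
      (continuousOn_id.pow 2) fun r hr => pow_ne_zero 2 hr.1.ne'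
  have ha : ∀ r ∈ Ioo 0 R, HasDerivAt (fun r => r ^ (n - 1) * a r) (r ^ (n - 1) * D r) r := by
    intro r hr
    have hr0 := hr.1.ne'
    refine ((hasDerivAt_pow_pred hn hr.1).mul (hasDerivAt_ray_div hu.euler θ hr0)).congr_deriv ?_
    simp only [hD_def, _root_.radialPart]
    field_simp
    ring
  have haeq : ∀ r, r ≠ 0 → a r = fderiv ℝ u (r • θ) θ := by
    intro r hr
    simp only [ha_def, _root_.euler, fieldDeriv, map_smul, smul_eq_mul]
    field_simp
  obtain ⟨C, -, hC⟩ := exists_abs_fieldDeriv_div_le (R := R) hu (ContinuousLinearMap.id ℝ _)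
  have hlim : Filter.Tendsto (fun r => r ^ (n - 1) * a r) (nhdsWithin 0 (Ioi 0)) (nhds 0) := by
    have hc : Continuous fun r : ℝ => r ^ (n - 1) * fderiv ℝ u (r • θ) θ :=
      (continuous_pow _).mul (((hu.continuous_fderiv (by simp)).comp
        (by fun_prop : Continuous fun r : ℝ => r • θ)).clm_apply continuous_const)
    have h0 := hc.tendsto 0
    rw [zero_smul, hrad.fderiv_zero hu, mul_zero] at h0
    refine (h0.mono_left nhdsWithin_le_nhds).congr' ?_
    filter_upwards [self_mem_nhdsWithin] with r hr
    rw [haeq r (ne_of_gt hr)]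
  set e : ℝ → ℝ := fun t => V t * t ^ (n - 1) * D t ^ 2 with he_def
  have he : ContinuousOn e (Ioo 0 R) :=
    (hV.continuousOn.mul (continuous_pow _).continuousOn).mul (hD.pow 2)
  have he0 : ∀ r ∈ Ioo 0 R, 0 ≤ e r := fun r hr =>
    mul_nonneg (mul_nonneg (hVpos r hr).le (pow_nonneg hr.1.le _)) (sq_nonneg _)
  -- The energy of `u` along a ray is finite, since `Δu` is radial.
  have hK : ∀ b, b < R → ∀ s ∈ Ioo 0 b, ∫ t in s..b, e t ≤ L / σ := by
    intro b hb s hs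
    rw [le_div_iff₀ hσpos]
    refine le_trans (mul_toSphere_le_setIntegral_annulus hs.1.le hs.2.le
      (G := fun x => V ‖x‖ * Laplacian.laplacian u x ^ 2) ?_ ?_) (hL s b hs.1 hs.2 hb)
    · exact ((continuousOn_comp_norm hV.continuousOn).mul
        (hu.laplacian.continuous.pow 2).continuousOn).integrableOn_annulus hs.1 hb
    · intro ζ hζ
      refine le_of_eq (intervalIntegral.integral_congr fun t ht => ?_)
      rw [uIcc_of_le hs.2.le] at ht
      have ht0 : 0 < t := hs.1.trans_le ht.1
      have hnorm := norm_smul_unit hζ ht0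
      have hlap := hrad.norm_sq_mul_laplacian hu (t • ζ)
      rw [hnorm, hrad.radialPart hu (t • ζ) (t • θ) (by rw [hnorm, norm_smul_unit hθ ht0])] at hlap
      have h1 : Laplacian.laplacian u (t • ζ) = D t := by
        simp only [hD_def]
        rw [eq_div_iff (by positivity), mul_comm, hlap]
      simp only [hnorm, h1, he_def]
      ring
  refine ⟨R₀, hR₀.2, fun η hη ε₀ hε₀ => ?_⟩
  set η' := η / (2 * σ) with hη'
  have hη'pos : 0 < η' := by positivity
  have hmid : R / 2 ∈ Ioo 0 R := ⟨by linarith, by linarith⟩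
  obtain ⟨r₁, hr₁, htail⟩ := exists_forall_integral_le he he0 (K := max (L / σ) 0) hmid
    (fun s hs => by
      rcases hs.2.lt_or_eq with h | h
      · exact (hK _ hmid.2 s ⟨hs.1, h⟩).trans (le_max_left _ _)
      · rw [h, intervalIntegral.integral_same]; exact le_max_right _ _) hη'pos
  set r₂ := min r₁ (ε₀ / 2) with hr₂
  have hr₂pos : 0 < r₂ := lt_min hr₁.1 (by linarith)
  have hr₂R : r₂ ∈ Ioo 0 R := ⟨hr₂pos, ((min_le_left _ _).trans hr₁.2).trans_lt hmid.2⟩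
  have hn' : (1 : ℝ) ≤ n := by exact_mod_cast hn
  obtain ⟨ε, hε, hPε⟩ : ∃ ε ∈ Ioc 0 r₂, ((n : ℝ) - 1) * (boundaryWeight n V ε * a ε ^ 2) ≤ η' := by
    obtain rfl | hn2 : n = 1 ∨ 2 ≤ n := by omega
    · exact ⟨r₂, ⟨hr₂pos, le_rfl⟩, by simpa using hη'pos.le⟩
    · have hpos : (0 : ℝ) < n - 1 := by
        have : (2 : ℝ) ≤ n := by exact_mod_cast hn2
        linarith
      obtain ⟨ε, hε, h⟩ := exists_boundaryWeight_mul_sq_le hn2 hV hVpos hD ha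
        (hC θ hθ) hr₂R (K := η') (fun s hs => htail r₂ ⟨hr₂pos, min_le_left _ _⟩ s hs)
        (δ := η' / (n - 1)) (by positivity)
      refine ⟨ε, hε, ?_⟩
      have := mul_le_mul_of_nonneg_left h hpos.le
      rwa [mul_div_cancel₀ _ hpos.ne'] at this
  have hεR : ε ∈ Ioo 0 R := ⟨hε.1, hε.2.trans_lt hr₂R.2⟩
  have hqε := hY.radialFlux_mul_sq_le hn hV hVpos hWnonneg hD ha hlim hεR
    (htail ε ⟨hε.1, hε.2.trans (min_le_left _ _)⟩)
  refine ⟨ε, hε.1, ?_, fun b hb hεb hbR => ?_⟩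
  · have := hε.2.trans (min_le_right _ _)
    linarith
  · have := hrad.le_setIntegral_annulus_rellichDensity (c := 2 * η') hn hV hVpos hW hY hu hε.1
      hεb.le hbR (hsupp₀.trans (Metric.ball_subset_ball hb.le)) (fun ζ hζ => by
        rw [hrad.euler hu (ε • ζ) (ε • θ)
          (by rw [norm_smul_unit hζ hε.1, norm_smul_unit hθ hε.1])]
        have e1 : a ε = _root_.euler u (ε • θ) / ε := rfl
        rw [← e1]
        linarith)
    have e2 : 2 * η' * σ = η := by rw [hη']; field_simp
    rw [neg_mul, e2] at this
    exact this

end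

/-! ### Passage to extended integrals over the ball -/

section

variable {n : ℕ} {R : ℝ} {V W : ℝ → ℝ} {u : EuclideanSpace ℝ (Fin n) → ℝ}

/-- For `n ≥ 1` the origin is a null set, so the centre of the ball can be removed. -/
lemma setLIntegral_ball_eq_annulus (hn : 1 ≤ n) (f : EuclideanSpace ℝ (Fin n) → ENNReal) :
    ∫⁻ x in Metric.ball 0 R, f x = ∫⁻ x in annulus n 0 R, f x := by
  have : Nonempty (Fin n) := ⟨⟨0, hn⟩⟩
  have : Nontrivial (EuclideanSpace ℝ (Fin n)) := by infer_instance
  refine setLIntegral_congr ?_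
  have h : annulus n 0 R = Metric.ball (0 : EuclideanSpace ℝ (Fin n)) R \ {0} := by
    ext x
    simp [annulus, and_comm]
  rw [h]
  exact (sdiff_null_ae_eq_self (measure_singleton _)).symm

/-- If `∫ (g - f)` over annuli shrinking to the punctured ball is asymptotically nonnegative,
for nonnegative continuous `f` and `g`, then `∫ f ≤ ∫ g` as extended numbers. -/
lemma setLIntegral_annulus_le {f g : EuclideanSpace ℝ (Fin n) → ℝ} (hR : 0 < R)
    (hf : ContinuousOn f (annulus n 0 R)) (hg : ContinuousOn g (annulus n 0 R))
    (hf0 : ∀ x ∈ annulus n 0 R, 0 ≤ f x) (hg0 : ∀ x ∈ annulus n 0 R, 0 ≤ g x)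
    {R₀ : ℝ} (hR₀ : R₀ < R)
    (hfg : ∀ η > (0 : ℝ), ∀ ε₀ > (0 : ℝ), ∃ ε, 0 < ε ∧ ε < ε₀ ∧ ∀ b, R₀ < b → ε < b → b < R →
      -η ≤ ∫ x in annulus n ε b, (g x - f x)) :
    ∫⁻ x in annulus n 0 R, ENNReal.ofReal (f x) ≤ ∫⁻ x in annulus n 0 R, ENNReal.ofReal (g x) := by
  have hpos : ∀ k : ℕ, 0 < R / (k + 3 : ℝ) := fun k => by positivity
  have hU : annulus n 0 R = ⋃ k : ℕ, annulus n (R / (k + 3 : ℝ)) (R - R / (k + 3 : ℝ)) := by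
    ext x
    simp only [annulus, mem_iUnion, mem_ofPred_eq]
    constructor
    · rintro ⟨h0, h1⟩
      have hm : 0 < min ‖x‖ (R - ‖x‖) := lt_min h0 (sub_pos.2 h1)
      obtain ⟨k, hk⟩ := exists_nat_gt (R / min ‖x‖ (R - ‖x‖))
      have hk' : R / (k + 3 : ℝ) < min ‖x‖ (R - ‖x‖) := by
        rw [div_lt_iff₀ hm] at hk
        rw [div_lt_iff₀ (by positivity)]
        nlinarith
      exact ⟨k, hk'.trans_le (min_le_left _ _), by linarith [hk'.trans_le (min_le_right _ _)]⟩
    · rintro ⟨k, h0, h1⟩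
      exact ⟨(hpos k).trans h0, h1.trans (sub_lt_self _ (hpos k))⟩
  have hmono : Monotone fun k : ℕ => annulus n (R / (k + 3 : ℝ)) (R - R / (k + 3 : ℝ)) := by
    intro k l hkl x hx
    have h : R / (l + 3 : ℝ) ≤ R / (k + 3 : ℝ) := by gcongr
    exact ⟨h.trans_lt hx.1, hx.2.trans_le (by linarith)⟩
  conv_lhs => rw [hU]
  rw [setLIntegral_iUnion_of_directed _ hmono.directed_le]
  refine iSup_le fun k => ENNReal.le_of_forall_pos_le_add fun η hη _ => ?_
  have hthird : R / (k + 3 : ℝ) ≤ R / 3 := by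
    gcongr
    linarith [(Nat.cast_nonneg k : (0 : ℝ) ≤ k)]
  obtain ⟨ε, hε, hεk, hbound⟩ := hfg η hη _ (hpos k)
  obtain ⟨b, hb, hbR⟩ := exists_between (max_lt hR₀ (sub_lt_self R (hpos k)))
  rw [max_lt_iff] at hb
  have hI := hbound b hb.1 (by linarith) hbR
  have hsub : annulus n ε b ⊆ annulus n 0 R := fun x hx => ⟨hε.trans hx.1, hx.2.trans hbR⟩
  have hfi := hf.integrableOn_annulus hε hbR
  have hgi := hg.integrableOn_annulus hε hbR
  rw [integral_sub hgi hfi] at hI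
  have hae : ∀ {h : EuclideanSpace ℝ (Fin n) → ℝ}, (∀ x ∈ annulus n 0 R, 0 ≤ h x) →
      0 ≤ᵐ[volume.restrict (annulus n ε b)] h := fun hh =>
    (ae_restrict_iff' (isOpen_annulus _ _).measurableSet).2 (.of_forall fun x hx => hh x (hsub hx))
  calc ∫⁻ x in annulus n (R / (k + 3 : ℝ)) (R - R / (k + 3 : ℝ)), ENNReal.ofReal (f x)
      ≤ ∫⁻ x in annulus n ε b, ENNReal.ofReal (f x) :=
        lintegral_mono_set fun x hx => ⟨hεk.trans hx.1, hx.2.trans hb.2⟩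
    _ = ENNReal.ofReal (∫ x in annulus n ε b, f x) :=
        (ofReal_integral_eq_lintegral_ofReal hfi (hae hf0)).symm
    _ ≤ ENNReal.ofReal (∫ x in annulus n ε b, g x) + η := by
        rw [← ENNReal.ofReal_coe_nnreal (p := η)]
        refine (ENNReal.ofReal_le_ofReal ?_).trans ENNReal.ofReal_add_le
        linarith
    _ = (∫⁻ x in annulus n ε b, ENNReal.ofReal (g x)) + η := by
        rw [ofReal_integral_eq_lintegral_ofReal hgi (hae hg0)]
    _ ≤ _ := add_le_add_left (lintegral_mono_set hsub) _

/-- The rearrangement of `w + c p ≤ L + c q` in `[-∞, ∞]`; it holds also if `q = ∞`, since then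
`w + c (p - q) = -∞`. -/
lemma EReal.add_mul_sub_le {L w p q : ENNReal} {c : ℝ} (hc : 0 ≤ c)
    (h : w + ENNReal.ofReal c * p ≤ L + ENNReal.ofReal c * q) :
    (w : EReal) + (c : EReal) * ((p : EReal) - (q : EReal)) ≤ (L : EReal) := by
  rcases hc.eq_or_lt with rfl | hc
  · simpa using h
  rcases eq_or_ne L ⊤ with rfl | hL
  · simp
  rcases eq_or_ne q ⊤ with rfl | hq
  · simp [EReal.sub_top, EReal.coe_mul_bot_of_pos hc]
  have hfin : w + ENNReal.ofReal c * p ≠ ⊤ := ne_top_of_le_ne_top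
    (ENNReal.add_ne_top.2 ⟨hL, ENNReal.mul_ne_top ENNReal.ofReal_ne_top hq⟩) h
  have hw : w ≠ ⊤ := (ENNReal.add_ne_top.1 hfin).1
  have hp : p ≠ ⊤ := by
    rintro rfl
    exact (ENNReal.add_ne_top.1 hfin).2
      (ENNReal.mul_top (ENNReal.ofReal_pos.2 hc).ne')
  lift L to NNReal using hL
  lift q to NNReal using hq
  lift w to NNReal using hw
  lift p to NNReal using hp
  lift c to NNReal using hc.le
  rw [ENNReal.ofReal_coe_nnreal] at h
  have h1 : w + c * p ≤ L + c * q := by exact_mod_cast h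
  have h2 : (w : ℝ) + c * p ≤ L + c * q := by exact_mod_cast h1
  have h3 : (w : ℝ) + c * ((p : ℝ) - q) ≤ L := by linarith
  simp only [EReal.coe_nnreal_eq_coe_real]
  exact_mod_cast h3

/-- The limit of the inequalities on annuli. The positive and negative parts of the integrand of
the last term are first moved to different sides, so that all integrands are nonnegative. -/
lemma HasAnnularBound.hardyRellichInequality (hn : 1 ≤ n) (hR : 0 < R)
    (hV : ContDiffOn ℝ 1 V (Ioo 0 R)) (hVpos : ∀ r ∈ Ioo 0 R, 0 < V r)
    (hWnonneg : ∀ r ∈ Ioo 0 R, 0 ≤ W r) (hW : ContinuousOn W (Ioo 0 R))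
    (hu : ContDiff ℝ ∞ u) (h : HasAnnularBound n R V W u) :
    HardyRellichInequality n R V W u := by
  obtain ⟨R₀, hR₀, hbound⟩ := h
  have hc : (0 : ℝ) ≤ (n : ℝ) - 1 := sub_nonneg.2 (by exact_mod_cast hn)
  set A := annulus n 0 R with hA
  have hAm : MeasurableSet A := (isOpen_annulus _ _).measurableSet
  set F : EuclideanSpace ℝ (Fin n) → ℝ := fun x => V ‖x‖ * Laplacian.laplacian u x ^ 2 with hF
  set G : EuclideanSpace ℝ (Fin n) → ℝ := fun x => W ‖x‖ * ‖gradient u x‖ ^ 2 with hG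
  set H : EuclideanSpace ℝ (Fin n) → ℝ :=
    fun x => (V ‖x‖ / ‖x‖ ^ 2 - deriv V ‖x‖ / ‖x‖) * ‖gradient u x‖ ^ 2 with hH
  have hF0 : ∀ x ∈ A, 0 ≤ F x := fun x hx => mul_nonneg (hVpos _ hx).le (sq_nonneg _)
  have hG0 : ∀ x ∈ A, 0 ≤ G x := fun x hx => mul_nonneg (hWnonneg _ hx) (sq_nonneg _)
  have h0 : ∀ r ∈ Ioo 0 R, r ≠ 0 := fun r hr => hr.1.ne'
  have hgrad := (hu.continuous_gradient.norm.pow 2).continuousOn (s := A)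
  have hFc : ContinuousOn F A := (continuousOn_comp_norm hV.continuousOn).mul
    (hu.laplacian.continuous.pow 2).continuousOn
  have hGc : ContinuousOn G A := (continuousOn_comp_norm hW).mul hgrad
  have hHc : ContinuousOn H A := (continuousOn_comp_norm (g := fun r => V r / r ^ 2 - deriv V r / r)
    ((hV.continuousOn.div (continuousOn_id.pow 2) fun r hr => pow_ne_zero 2 (h0 r hr)).sub
      ((hV.continuousOn_deriv_of_isOpen isOpen_Ioo le_rfl).div continuousOn_id h0))).mul hgrad
  have hsplit : ∀ (f g : EuclideanSpace ℝ (Fin n) → ℝ), ContinuousOn f A → (∀ x ∈ A, 0 ≤ f x) →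
      ∫⁻ x in A, ENNReal.ofReal (f x + ((n : ℝ) - 1) * max (g x) 0)
        = (∫⁻ x in A, ENNReal.ofReal (f x))
          + ENNReal.ofReal ((n : ℝ) - 1) * ∫⁻ x in A, ENNReal.ofReal (g x) := by
    intro f g hf hf0
    rw [← lintegral_const_mul' _ _ ENNReal.ofReal_ne_top,
      ← lintegral_add_left' (hf.aemeasurable hAm).ennreal_ofReal]
    refine setLIntegral_congr_fun hAm fun x hx => ?_
    rw [ENNReal.ofReal_add (hf0 x hx) (mul_nonneg hc (le_max_right _ _)),
      ENNReal.ofReal_mul hc, ENNReal.ofReal_max, ENNReal.ofReal_zero, max_eq_left zero_le]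
  have hkey := setLIntegral_annulus_le hR
    (f := fun x => G x + ((n : ℝ) - 1) * max (H x) 0)
    (g := fun x => F x + ((n : ℝ) - 1) * max (-H x) 0)
    (hGc.add (continuousOn_const.mul (hHc.sup continuousOn_const)))
    (hFc.add (continuousOn_const.mul (hHc.neg.sup continuousOn_const)))
    (fun x hx => add_nonneg (hG0 x hx) (mul_nonneg hc (le_max_right _ _)))
    (fun x hx => add_nonneg (hF0 x hx) (mul_nonneg hc (le_max_right _ _))) hR₀ (by
      have hd : rellichDensity V W u = fun x => F x + ((n : ℝ) - 1) * max (-H x) 0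
          - (G x + ((n : ℝ) - 1) * max (H x) 0) := by
        funext x
        have h1 := max_zero_sub_max_neg_zero_eq_self (H x)
        have h2 : rellichDensity V W u x = F x - G x - ((n : ℝ) - 1) * H x := by
          simp only [rellichDensity, hF, hG, hH]
          ring
        rw [h2]
        linear_combination ((n : ℝ) - 1) * h1
      rw [hd] at hbound
      exact hbound)
  rw [hsplit G H hGc hG0, hsplit F (fun x => -H x) hFc hF0] at hkey
  have hneg : ∀ f : EuclideanSpace ℝ (Fin n) → ℝ, (∀ x ∈ A, 0 ≤ f x) →
      ∫⁻ x in A, ENNReal.ofReal (-f x) = 0 := fun f hf => by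
    rw [setLIntegral_congr_fun hAm (g := fun _ => 0) fun x hx =>
      ENNReal.ofReal_of_nonpos (neg_nonpos.2 (hf x hx)), lintegral_zero]
  simp only [HardyRellichInequality, ballIntegral, setLIntegral_ball_eq_annulus hn, ge_iff_le]
  rw [hneg F hF0, hneg G hG0]
  simp only [EReal.coe_ennreal_zero, sub_zero]
  exact EReal.add_mul_sub_le hc hkey

/-- If `∫ V |Δu|²` is infinite, the inequality is trivial; otherwise it bounds the integrals
over annuli, as the radial case requires. -/
lemma IsRadial.hardyRellichInequality {Y : ℝ → ℝ} (hn : 1 ≤ n) (hR : 0 < R)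
    (hV : ContDiffOn ℝ 1 V (Ioo 0 R)) (hVpos : ∀ r ∈ Ioo 0 R, 0 < V r)
    (hWnonneg : ∀ r ∈ Ioo 0 R, 0 ≤ W r) (hW : ContinuousOn W (Ioo 0 R))
    (hY : IsRiccati n R V W Y) (hu : IsTestFunction n R u) (hrad : IsRadial n u) :
    HardyRellichInequality n R V W u := by
  set F : EuclideanSpace ℝ (Fin n) → ℝ := fun x => V ‖x‖ * Laplacian.laplacian u x ^ 2 with hF
  have hF0 : ∀ x ∈ annulus n 0 R, 0 ≤ F x :=
    fun x hx => mul_nonneg (hVpos _ hx).le (sq_nonneg _)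
  by_cases hL : ∫⁻ x in annulus n 0 R, ENNReal.ofReal (F x) = ⊤
  · have hneg : ∫⁻ x in annulus n 0 R, ENNReal.ofReal (-F x) = 0 := by
      rw [setLIntegral_congr_fun (isOpen_annulus _ _).measurableSet (g := fun _ => 0) fun x hx =>
        ENNReal.ofReal_of_nonpos (neg_nonpos.2 (hF0 x hx)), lintegral_zero]
    have htop : ballIntegral n R F = ⊤ := by
      simp [ballIntegral, setLIntegral_ball_eq_annulus hn, hL, hneg]
    rw [HardyRellichInequality, htop]
    exact le_top
  refine (hrad.hasAnnularBound hn hR hV hVpos hWnonneg hW hY hu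
    (L := (∫⁻ x in annulus n 0 R, ENNReal.ofReal (F x)).toReal)
    fun ε b hε _ hb => ?_).hardyRellichInequality hn hR hV hVpos hWnonneg hW hu.1
  have hsub : annulus n ε b ⊆ annulus n 0 R := fun x hx => ⟨hε.trans hx.1, hx.2.trans hb⟩
  have hFc : ContinuousOn F (annulus n 0 R) := (continuousOn_comp_norm hV.continuousOn).mul
    (hu.1.laplacian.continuous.pow 2).continuousOn
  rw [integral_eq_lintegral_of_nonneg_ae ((ae_restrict_iff' (isOpen_annulus _ _).measurableSet).2
    (.of_forall fun x hx => hF0 x (hsub hx)))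
    (hFc.integrableOn_annulus hε hb).aestronglyMeasurable]
  exact ENNReal.toReal_mono hL (lintegral_mono_set hsub)

end

theorem mainTheorem3 (n : ℕ) (hn : 1 ≤ n) (R : ℝ) (hR : 0 < R) (V W : ℝ → ℝ)
    (hV : ContDiffOn ℝ 1 V (Ioo 0 R)) (hVpos : ∀ r ∈ Ioo 0 R, 0 < V r)
    (hWnonneg : ∀ r ∈ Ioo 0 R, 0 ≤ W r) (hVW : IsBesselPair n R V W) :
    (∀ u : EuclideanSpace ℝ (Fin n) → ℝ, IsTestFunction n R u → IsRadial n u →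
      HardyRellichInequality n R V W u) ∧
    (ContDiffOn ℝ 2 V (Ioo 0 R) →
      (∀ r ∈ Ioo 0 R,
        0 ≤ W r - 2 * V r / r ^ 2 + 2 * deriv V r / r - deriv (deriv V) r) →
      ∀ u : EuclideanSpace ℝ (Fin n) → ℝ, IsTestFunction n R u →
        HardyRellichInequality n R V W u) := by
  obtain ⟨Y, hY⟩ := hVW.exists_isRiccati
  have hW := hVW.continuousOn hV hVpos
  exact ⟨fun u hu hrad => hrad.hardyRellichInequality hn hR hV hVpos hWnonneg hW hY hu,
    fun hV2 hcond u hu => (hasAnnularBound_of_curvature hn hR hV2 hVpos hWnonneg hW hY hcond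
      hu).hardyRellichInequality hn hR hV hVpos hWnonneg hW hu.1⟩
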